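/- **Model.** A dual graph network of size $n$ is a pair $(G,G')$ of graphs on the same $n$ nodes with $E(G)\subseteq E(G')$; let $\Delta'$ be the maximum $G'$-degree (an upper bound on the contention). A distributed algorithm is a collection of $n$ randomized processes with ids (probabilistic automata); an adversary assigns the processes to the nodes by a bijection $proc$ unknown to the processes, while the algorithm may depend on $(G,G')$ and on the sender set. In each round $1,2,\dots$ processes first get inputs $bcast(m)$ (every $m$ is input at most once, and a node gets a new input only after its earlier ones have been acknowledged) and decide whether and what to transmit; then the adversary, knowing all states, chooses a reach set $R$ with $E(G)\subseteq R\subseteq E(G')$. A transmitting process receives only its own message; any other process receives a message if exactly one of its $R$-neighbors transmits, and silence otherwise. Then processes may output $ack(m)$ and $rcv(m)$. In a centralized algorithm the decisions of the processes about transmitting may also depend on $proc$ and on the current states and inputs of all processes. The message set is infinite. An algorithm is a *local broadcast algorithm* for $(G,G')$ if, for every $proc$ and every adversary and environment: (1) in every execution each $bcast(m)_u$ is answered by exactly one $ack(m)_u$, and there are no other $ack$ outputs; (2) in every execution each node $v$ outputs $rcv(m)_v$ at most once, and only if some $G'$-neighbor $u$ of $v$ has received $bcast(m)_u$ and has not output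 $ack(m)_u$ in an earlier round; (3) for all $u$ and $m$, with probability at least $1-\frac1n$: if $u$ receives $bcast(m)_u$ in round $r$ and outputs $ack(m)_u$ in round $r'$, then every $G$-neighbor $v$ of $u$ outputs $rcv(m)_v$ in a round of $[r,r']$. For a sender set $S$, consider the executions in which exactly the nodes of $S$ receive a $bcast$ input, all in round $1$. The average progress of such an execution is the average, over all nodes with a $G$-neighbor in $S$, of the first round in which the node outputs some $rcv(m)$ ($\infty$ if there is none). An algorithm *has average progress $f$* for $(G,G')$ and $S$ if for every $proc$, every assignment of distinct messages to $S$ and every adversary this value is at most $f$ with probability at least $1-\frac1n$. **Spread network.** For $n\ge2$ let $m=\lfloor n/2\rfloor$, with broadcasters $b_1,\dots,b_m$ and receivers $r_1,\dots,r_{n-m}$. The edges of $G$ are $b_ir_i$ for $1\le i\le m$ and $b_1r_j$ for all $j$; $G'$ is complete, so $\Delta'=n-1$. **Theorem.** There are constants $C$ and $c>0$ such that for every $n\ge 2$, in the spread network of size $n$ with sender set $S=\{b_1,\dots,b_m\}$: 1. some centralized local broadcast algorithm has average progress $C$; 2. whenever a distributed local broadcast algorithm (it suffices that it solves local broadcast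 in the one-shot setting, where all $bcast$ inputs arrive in round $1$) has average progress $f$, then $f\ge c\,\Delta'=c\,(n-1)$. -/

import Mathlib

open scoped ENNReal NNReal

noncomputable section

namespace DualRadio

/-! ## Dual graph networks -/

/-- A dual graph network on the node set `V`: the reliable graph `G` is contained in the graph `G'`
of all (reliable and unreliable) links. -/
structure DualGraph (V : Type) where
  G : SimpleGraph V
  G' : SimpleGraph V
  le : G ≤ G'

/-- The maximum `G'`-degree of the network. -/
def DualGraph.maxDegree' {V : Type} [Fintype V] (N : DualGraph V) : ℕ :=
  Finset.univ.sup fun v => (N.G'.neighborSet v).ncard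

/-! ## Algorithms -/

/-- What a process gets at the end of the communication part of a round: its own message if it
transmitted, the message it received from another node, or silence (which is also what it gets
in the case of a collision). -/
inductive Reception (P : Type) where
  | sent (p : P)
  | received (p : P)
  | silence

/-- A distributed algorithm for messages in `M`: a collection of `n` randomized processes with
identifiers in `Fin n`. Each is a probabilistic automaton with transitions given by discrete
distributions. In a round the process `i` gets at most one `bcast` input and makes a random
transition (`step`); the new state determines whether and what it transmits (`packet`; the alphabet
`Packet` of radio messages is chosen by the algorithm); after the reception it makes another random
transition (`recv`) that also produces the outputs of the round: possibly an `ack`, and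
a finite set of `rcv` outputs. -/
structure DistributedAlgorithm (n : ℕ) (M : Type) where
  Packet : Type
  State : Fin n → Type
  init : ∀ i, State i
  step : ∀ i, State i → Option M → PMF (State i)
  packet : ∀ i, State i → Option Packet
  recv : ∀ i, State i → Reception Packet → PMF (State i × Option M × Finset M)

/-- A centralized algorithm: whether process `i` transmits in a round may in addition depend on the
assignment `proc` of processes to nodes and on the current states and inputs of all processes.
Only this decision uses global knowledge: what is transmitted, and above all the
`rcv` outputs, depend on what the process itself knows, so that messages still have
to be delivered over the radio channel. -/
structure CentralizedAlgorithm (V : Type) (n : ℕ) (M : Type) extends DistributedAlgorithm n M where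
  permit : (proc : V ≃ Fin n) → (states : ∀ i, State i) → (inputs : Fin n → Option M) →
    (i : Fin n) → Prop

/-- A distributed algorithm, regarded as a centralized one that ignores the global knowledge. -/
def DistributedAlgorithm.toCentralized (V : Type) {n : ℕ} {M : Type}
    (A : DistributedAlgorithm n M) : CentralizedAlgorithm V n M where
  toDistributedAlgorithm := A
  permit _ _ _ _ := True

/-! ## Executions -/

/-- Independent choices from finitely many discrete distributions (the product distribution). -/
def independent : {n : ℕ} → {α : Fin n → Type} → (∀ i, PMF (α i)) → PMF (∀ i, α i)
  | 0, _, _ => PMF.pure fun i => i.elim0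
  | _ + 1, _, p =>
      (p 0).bind fun a => (independent fun i => p i.succ).bind fun b => PMF.pure (Fin.cons a b)

section Executions

variable {V : Type} {n : ℕ} {M : Type}

/-- The record of one round: the `bcast` input at each node, the states of the processes
when they decide about transmitting, their states at the end of the round, and their outputs. -/
structure Round (A : CentralizedAlgorithm V n M) where
  bcast : V → Option M
  mid : ∀ i, A.State i
  final : ∀ i, A.State i
  ackOut : Fin n → Option M
  rcvOut : Fin n → Finset M

namespace CentralizedAlgorithm

variable (A : CentralizedAlgorithm V n M)

/-- The states of the processes after the rounds of `h` (oldest round first). -/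
def current (h : List (Round A)) : ∀ i, A.State i :=
  match h.getLast? with
  | none => A.init
  | some ρ => ρ.final

/-- The transmission, if any, of the process at node `v`. -/
def transmission (proc : V ≃ Fin n) (inp : V → Option M) (mid : ∀ i, A.State i) (v : V) :
    Option A.Packet :=
  open Classical in
  if A.permit proc mid (fun i => inp (proc.symm i)) (proc v) then A.packet (proc v) (mid (proc v))
  else none

end CentralizedAlgorithm

/-- What node `v` gets when the nodes transmit according to `tr` and the links in `R` work. -/
def reception {P : Type} (R : SimpleGraph V) (tr : V → Option P) (v : V) : Reception P :=
  open Classical in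
  match tr v with
  | some p => .sent p
  | none =>
      if h : ∃! u, R.Adj u v ∧ (tr u).isSome then
        .received ((tr h.choose).get h.choose_spec.1.2)
      else .silence

/-- An adversary, who also controls the environment. Knowing the complete history, it
chooses the `bcast` inputs of the next round; knowing moreover the states of all processes at
the time when they transmit, it chooses the reach set of this round. -/
structure Adversary (N : DualGraph V) (A : CentralizedAlgorithm V n M) where
  bcast : List (Round A) → V → Option M
  reach : List (Round A) → (∀ i, A.State i) → SimpleGraph V
  le_reach : ∀ h s, N.G ≤ reach h s
  reach_le : ∀ h s, reach h s ≤ N.G'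

variable {N : DualGraph V} {A : CentralizedAlgorithm V n M}

/-- The distribution of the next round after the history `h`. -/
def nextRound (proc : V ≃ Fin n) (adv : Adversary N A) (h : List (Round A)) : PMF (Round A) :=
  let inp := adv.bcast h
  (independent fun i => A.step i (A.current h i) (inp (proc.symm i))).bind fun mid =>
    let tr := A.transmission proc inp mid
    (independent fun i =>
        A.recv i (mid i) (reception (adv.reach h mid) tr (proc.symm i))).bind fun out =>
      PMF.pure
        { bcast := inp
          mid := mid
          final := fun i => (out i).1
          ackOut := fun i => (out i).2.1
          rcvOut := fun i => (out i).2.2 }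

/-- The distribution of the history of the first `k` rounds. -/
def histories (proc : V ≃ Fin n) (adv : Adversary N A) : ℕ → PMF (List (Round A))
  | 0 => PMF.pure []
  | k + 1 => (histories proc adv k).bind fun h =>
      (nextRound proc adv h).bind fun ρ => PMF.pure (h ++ [ρ])

/-- The probability of an event that concerns the first `k` rounds. -/
def prob (proc : V ≃ Fin n) (adv : Adversary N A) (k : ℕ) (E : Set (List (Round A))) : ℝ≥0∞ :=
  (histories proc adv k).toOuterMeasure E

/-- `e` is an (infinite) execution: each of its rounds is a possible next round. -/
def IsExecution (proc : V ≃ Fin n) (adv : Adversary N A) (e : ℕ → Round A) : Prop :=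
  ∀ t, e t ∈ (nextRound proc adv ((List.range t).map e)).support

/-- In the round `ρ`, the input `bcast(m)` arrives at node `u`. -/
def Round.Bcast (ρ : Round A) (u : V) (m : M) : Prop := ρ.bcast u = some m

/-- In the round `ρ`, the process at node `u` outputs `ack(m)`. -/
def Round.Ack (proc : V ≃ Fin n) (ρ : Round A) (u : V) (m : M) : Prop :=
  ρ.ackOut (proc u) = some m

/-- In the round `ρ`, the process at node `u` outputs `rcv(m)`. -/
def Round.Rcv (proc : V ≃ Fin n) (ρ : Round A) (u : V) (m : M) : Prop :=
  m ∈ ρ.rcvOut (proc u)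

/-! ## The local broadcast problem -/

/-- The environment is well-formed: a message is the subject of at most one `bcast` input,
and a node gets a `bcast` input only when all its earlier ones have been acknowledged. -/
def Adversary.WellFormed (proc : V ≃ Fin n) (adv : Adversary N A) : Prop :=
  ∀ h u m, adv.bcast h u = some m →
    (∀ ρ ∈ h, ∀ w, ¬ ρ.Bcast w m) ∧
    (∀ w, adv.bcast h w = some m → w = u) ∧
    ∀ (s : ℕ) (ρ : Round A) (m' : M), h[s]? = some ρ → ρ.Bcast u m' →
      ∃ (s' : ℕ) (ρ' : Round A), s ≤ s' ∧ h[s']? = some ρ' ∧ ρ'.Ack proc u m'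

/-- The one-shot setting: all `bcast` inputs arrive at the beginning of the first round. -/
def Adversary.OneShot (proc : V ≃ Fin n) (adv : Adversary N A) : Prop :=
  adv.WellFormed proc ∧ ∀ h, h ≠ [] → ∀ u, adv.bcast h u = none

/-- Acknowledgments in an execution: each `bcast(m)` at `u` is answered by exactly
one `ack(m)` at `u`, not earlier than the `bcast(m)`, and there are no other acknowledgments. -/
def GoodAcks (proc : V ≃ Fin n) (e : ℕ → Round A) : Prop :=
  (∀ u m, (∃ r, (e r).Bcast u m) → ∃! r', (e r').Ack proc u m) ∧
  ∀ r' u m, (e r').Ack proc u m → ∃ r ≤ r', (e r).Bcast u m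

/-- Receive outputs in an execution: each node outputs `rcv(m)` at most once, and only
when it has a `G'`-neighbor that has got the input `bcast(m)` and has not
output `ack(m)` in an earlier round. -/
def GoodRcvs (N : DualGraph V) (proc : V ≃ Fin n) (e : ℕ → Round A) : Prop :=
  (∀ v m r₁ r₂, (e r₁).Rcv proc v m → (e r₂).Rcv proc v m → r₁ = r₂) ∧
  ∀ v m r, (e r).Rcv proc v m →
    ∃ u, N.G'.Adj v u ∧ (∃ s ≤ r, (e s).Bcast u m) ∧ ∀ s < r, ¬ (e s).Ack proc u m

/-- In the history `h`, the node `u` got `bcast(m)` in round `r` and output `ack(m)` in round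
`r' ≥ r`, but some `G`-neighbor of `u` did not output `rcv(m)` in the round interval `[r, r']`. -/
def AckedTooEarly (N : DualGraph V) (proc : V ≃ Fin n) (u : V) (m : M) (h : List (Round A)) :
    Prop :=
  ∃ (r r' : ℕ) (ρ ρ' : Round A), r ≤ r' ∧ h[r]? = some ρ ∧ h[r']? = some ρ' ∧
    ρ.Bcast u m ∧ ρ'.Ack proc u m ∧
    ∃ v, N.G.Adj u v ∧
      ∀ (s : ℕ) (σ : Round A), r ≤ s → s ≤ r' → h[s]? = some σ → ¬ σ.Rcv proc v m

/-- The three requirements of the local broadcast problem, for a given adversary.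
The last one holds with probability at least `1 - 1/n` for each `u` and `m`:
the events in question increase with the number `k` of rounds, so that the probability of failure in
an infinite execution is at most `1/n` iff it is at most `1/n` in the first `k` rounds for all `k`. -/
def SolvesAgainst (proc : V ≃ Fin n) (adv : Adversary N A) : Prop :=
  (∀ e, IsExecution proc adv e → GoodAcks proc e ∧ GoodRcvs N proc e) ∧
  ∀ u m k, prob proc adv k {h | AckedTooEarly N proc u m h} ≤ 1 / (n : ℝ≥0∞)

/-- `A` solves the local broadcast problem in the network `N` (for all assignments of processes
to nodes, all well-formed environments, and all choices of reach sets). -/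
def SolvesLocalBroadcast (N : DualGraph V) (A : CentralizedAlgorithm V n M) : Prop :=
  ∀ (proc : V ≃ Fin n) (adv : Adversary N A), adv.WellFormed proc → SolvesAgainst proc adv

/-- `A` solves the local broadcast problem in the network `N` in the one-shot setting. Every
algorithm that solves the local broadcast problem has this property. -/
def SolvesOneShot (N : DualGraph V) (A : CentralizedAlgorithm V n M) : Prop :=
  ∀ (proc : V ≃ Fin n) (adv : Adversary N A), adv.OneShot proc → SolvesAgainst proc adv

theorem SolvesLocalBroadcast.solvesOneShot {N : DualGraph V} {A : CentralizedAlgorithm V n M}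
    (h : SolvesLocalBroadcast N A) : SolvesOneShot N A :=
  fun proc adv hadv => h proc adv hadv.1

/-! ## Average progress -/

/-- The (one-based) number of the round of `h` in which `v` first receives a message; `⊤` if `v`
receives none during `h`. -/
def firstReceive (proc : V ≃ Fin n) (h : List (Round A)) (v : V) : ℕ∞ :=
  ⨅ (t : ℕ) (_ : ∃ ρ, h[t]? = some ρ ∧ ∃ m, ρ.Rcv proc v m), ((t + 1 : ℕ) : ℕ∞)

/-- The nodes that have a `G`-neighbor in the sender set `S`. -/
def receivers [Fintype V] (N : DualGraph V) (S : Finset V) : Finset V :=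
  open Classical in Finset.univ.filter fun v => ∃ u ∈ S, N.G.Adj u v

/-- The average over all receivers of the round in which they first receive a message. -/
def averageProgress [Fintype V] (N : DualGraph V) (S : Finset V) (proc : V ≃ Fin n)
    (h : List (Round A)) : ℝ≥0∞ :=
  (∑ v ∈ receivers N S, (firstReceive proc h v : ℝ≥0∞)) / ((receivers N S).card : ℝ≥0∞)

/-- `A` has average progress `f` in the network `N` with sender set `S`: in every one-shot execution
in which exactly the nodes in `S` get messages, the average progress is at most `f` with
probability at least `1 - 1/n`. The events `averageProgress ≤ f` increase
with the number `k` of rounds, so the supremum is the probability of their union. -/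
def HasAverageProgress [Fintype V] (N : DualGraph V) (S : Finset V)
    (A : CentralizedAlgorithm V n M) (f : ℝ≥0) : Prop :=
  ∀ (proc : V ≃ Fin n) (adv : Adversary N A), adv.OneShot proc →
    (∀ u, (adv.bcast [] u).isSome ↔ u ∈ S) →
    1 - 1 / (n : ℝ≥0∞) ≤ ⨆ k, prob proc adv k {h | averageProgress N S proc h ≤ f}

end Executions

/-! ## The spread network -/

/-- The reliable links of the spread network on `n` nodes, with `m = ⌊n/2⌋`: the nodes `0, …, m-1`
are the broadcasters, the nodes `m, …, n-1` the receivers; the broadcaster `i` is joined to the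
receiver `m + i`, and the broadcaster `0` is joined to all receivers. -/
def spreadG (n : ℕ) : SimpleGraph (Fin n) :=
  SimpleGraph.fromRel fun b r =>
    b.val < n / 2 ∧ n / 2 ≤ r.val ∧ (r.val = n / 2 + b.val ∨ b.val = 0)

/-- The spread network; all pairs of nodes are joined in `G'`. -/
def spreadNetwork (n : ℕ) : DualGraph (Fin n) where
  G := spreadG n
  G' := ⊤
  le := le_top

/-- The sender set of the spread network: all broadcasters. -/
def broadcasters (n : ℕ) : Finset (Fin n) :=
  Finset.univ.filter fun b => b.val < n / 2

end DualRadio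

end

namespace DualRadio

/-! ## Independent choices -/

/-! Upper bound: under `roundRobin` at most one node transmits per round. A lone transmitter reaches
all its `G`-neighbors whatever the reach set, so it may acknowledge at once. Node `0` has the first
turn and is joined to every receiver, so all receivers are served in round one.

Lower bound: a distributed algorithm does not know which process sits at node `0`. With the links of
`jamming`, simultaneous transmissions collide at every listening node, a lone receiver is heard only
by broadcasters, and a lone broadcaster other than node `0` only by its own receiver. Hence each
round serves at most one receiver until node `0` transmits alone. Up to that moment, putting process
`j` at node `0` gives the same distribution as a reference network that does not depend on `j`,
where each lone broadcaster reaches only its partner (`reception_swapPairs`, `histories_relabel`).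
Since at most one process is alone per round, averaging over `j` in the reference network yields a
`j` that is alone during the first `n / 4` rounds with probability at most `(n / 4) / (n / 2)`
(`exists_prob_lone_le`). This is below `1 - 1/n`, and otherwise at least half of the receivers hear
nothing for `n / 4` rounds (`le_averageProgress`).

Hearing nothing does not by itself forbid `rcv` outputs, since a process might guess. But the same
silent behavior is possible in an execution without any inputs, where every `rcv` output violates
`GoodRcvs` (`rcvOut_eq_empty_of_silent`). -/

theorem independent_apply {n : ℕ} {α : Fin n → Type} (p : ∀ i, PMF (α i)) (f : ∀ i, α i) :
    independent p f = ∏ i, p i (f i) := by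
  classical
  induction n with
  | zero =>
    have : f = fun i => i.elim0 := funext fun i => i.elim0
    simp [independent, this]
  | succ n ih =>
    simp only [independent, PMF.bind_apply, PMF.pure_apply]
    rw [tsum_eq_single (f 0), tsum_eq_single (Fin.tail f), ih, Fin.prod_univ_succ]
    · simp [Fin.tail]
    · intro b hb
      rw [if_neg, mul_zero]
      rintro h
      exact hb (by rw [h, Fin.tail_cons])
    · intro a ha
      rw [mul_eq_zero, ENNReal.tsum_eq_zero]
      refine Or.inr fun b => ?_
      rw [if_neg, mul_zero]
      rintro h
      exact ha (by rw [h, Fin.cons_zero])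

section General

variable {V : Type} {n : ℕ} {M : Type} {N : DualGraph V} {A : CentralizedAlgorithm V n M}

/-! ## Rounds and histories -/

-- The record of a round determines all random choices made in it, so the sums over intermediate
-- choices collapse to one term. This explicit product allows two networks to be compared factor by
-- factor.
open Classical in
theorem nextRound_apply (proc : V ≃ Fin n) (adv : Adversary N A) (h : List (Round A))
    (ρ : Round A) :
    nextRound proc adv h ρ = if ρ.bcast = adv.bcast h then
      (∏ i, A.step i (A.current h i) (adv.bcast h (proc.symm i)) (ρ.mid i)) *
      ∏ i, A.recv i (ρ.mid i) (reception (adv.reach h ρ.mid)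
          (A.transmission proc (adv.bcast h) ρ.mid) (proc.symm i))
        (ρ.final i, ρ.ackOut i, ρ.rcvOut i) else 0 := by
  simp only [nextRound, PMF.bind_apply, PMF.pure_apply]
  rw [tsum_eq_single ρ.mid, tsum_eq_single (fun i => (ρ.final i, ρ.ackOut i, ρ.rcvOut i)),
    independent_apply, independent_apply]
  · by_cases hb : ρ.bcast = adv.bcast h
    · rw [if_pos hb, if_pos, mul_one]
      rw [← hb]
    · rw [if_neg hb, if_neg, mul_zero, mul_zero]
      intro hρ
      exact hb (by rw [hρ])
  · intro b hb
    rw [if_neg, mul_zero]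
    intro hρ
    apply hb
    rw [hρ]
  · intro a ha
    rw [mul_eq_zero, ENNReal.tsum_eq_zero]
    refine Or.inr fun b => ?_
    rw [if_neg, mul_zero]
    intro hρ
    exact ha (by rw [hρ])

theorem mem_support_nextRound {proc : V ≃ Fin n} {adv : Adversary N A} {h : List (Round A)}
    {ρ : Round A} :
    ρ ∈ (nextRound proc adv h).support ↔ ρ.bcast = adv.bcast h ∧
      (∀ i, ρ.mid i ∈ (A.step i (A.current h i) (adv.bcast h (proc.symm i))).support) ∧
      ∀ i, (ρ.final i, ρ.ackOut i, ρ.rcvOut i) ∈ (A.recv i (ρ.mid i)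
        (reception (adv.reach h ρ.mid) (A.transmission proc (adv.bcast h) ρ.mid)
          (proc.symm i))).support := by
  rw [PMF.mem_support_iff, nextRound_apply]
  simp [PMF.mem_support_iff, Finset.prod_ne_zero_iff]

theorem current_concat (h : List (Round A)) (ρ : Round A) : A.current (h ++ [ρ]) = ρ.final := by
  simp [CentralizedAlgorithm.current]

theorem histories_succ_nil (proc : V ≃ Fin n) (adv : Adversary N A) (k : ℕ) :
    histories proc adv (k + 1) [] = 0 := by
  classical
  simp [histories, PMF.bind_apply, PMF.pure_apply]

theorem histories_succ_concat (proc : V ≃ Fin n) (adv : Adversary N A) (k : ℕ)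
    (h : List (Round A)) (ρ : Round A) :
    histories proc adv (k + 1) (h ++ [ρ]) = histories proc adv k h * nextRound proc adv h ρ := by
  classical
  simp only [histories, PMF.bind_apply, PMF.pure_apply]
  rw [tsum_eq_single h, tsum_eq_single ρ]
  · simp
  · intro b hb
    rw [if_neg, mul_zero]
    simpa using hb.symm
  · intro a ha
    rw [mul_eq_zero, ENNReal.tsum_eq_zero]
    refine Or.inr fun b => ?_
    rw [if_neg, mul_zero]
    intro hh
    exact ha (List.append_inj_left' hh rfl).symm

/-- Each entry of the list `h` is one of the continuations `next g` of the list `g` of the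
entries before it. -/
def Follows {α : Type*} (next : List α → Set α) (h : List α) : Prop :=
  ∀ g a, g ++ [a] <+: h → a ∈ next g

theorem follows_nil {α : Type*} (next : List α → Set α) : Follows next [] := by
  intro g a h
  simp at h

theorem follows_concat {α : Type*} {next : List α → Set α} {h : List α} {a : α} :
    Follows next (h ++ [a]) ↔ Follows next h ∧ a ∈ next h := by
  constructor
  · intro H
    exact ⟨fun g b hg => H g b (hg.trans (List.prefix_append _ _)), H h a (List.prefix_refl _)⟩
  · rintro ⟨H, ha⟩ g b hg
    rcases List.prefix_concat_iff.1 hg with hg | hg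
    · rw [(List.append_inj_left' hg rfl : g = h)]
      have := List.append_inj_right' hg rfl
      simp at this
      rwa [this]
    · exact H g b hg

theorem Follows.getElem {α : Type*} {next : List α → Set α} {h : List α} (H : Follows next h)
    (t : ℕ) (ht : t < h.length) : h[t] ∈ next (h.take t) := by
  apply H
  rw [List.take_concat_get' h t ht]
  exact List.take_prefix _ _

/-- The local broadcast conditions speak of infinite executions, whereas the constructions below
produce finite histories; this bridges the gap. -/
theorem Follows.exists_extension {α : Type*} {next : List α → Set α} {h : List α}
    (H : Follows next h) (hne : ∀ g, (next g).Nonempty) :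
    ∃ e : ℕ → α, (∀ t, e t ∈ next ((List.range t).map e)) ∧
      ∀ t (ht : t < h.length), e t = h[t] := by
  -- Beyond the end of `h` any possible continuation will do.
  let entry : ℕ → List α → α := fun t g =>
    if ht : t < h.length then h[t] else (hne g).some
  let F : ℕ → List α := fun t => Nat.rec [] (fun t g => g ++ [entry t g]) t
  have hF : ∀ t, F (t + 1) = F t ++ [entry t (F t)] := fun t => rfl
  have hmap : ∀ t, (List.range t).map (fun t => entry t (F t)) = F t := by
    intro t
    induction t with
    | zero => rfl
    | succ t ih => rw [List.range_succ, List.map_append, ih, hF]; rfl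
  have htake : ∀ t ≤ h.length, F t = h.take t := by
    intro t
    induction t with
    | zero => intro _; simp [F]
    | succ t ih =>
      intro ht
      rw [hF, ih (by omega), ← List.take_concat_get' h t (by omega)]
      simp [entry, show t < h.length by omega]
  refine ⟨fun t => entry t (F t), fun t => ?_, fun t ht => by simp [entry, ht]⟩
  rw [hmap]
  by_cases ht : t < h.length
  · simp only [entry, ht, dite_true]
    rw [htake t ht.le]
    exact H.getElem t ht
  · simp only [entry, ht, dite_false]
    exact (hne _).some_mem

theorem mem_support_histories {proc : V ≃ Fin n} {adv : Adversary N A} {k : ℕ}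
    {h : List (Round A)} :
    h ∈ (histories proc adv k).support ↔
      h.length = k ∧ Follows (fun g => (nextRound proc adv g).support) h := by
  induction k generalizing h with
  | zero =>
    simp only [histories, PMF.support_pure, Set.mem_singleton_iff, List.length_eq_zero_iff]
    constructor
    · rintro rfl
      exact ⟨rfl, follows_nil _⟩
    · exact fun H => H.1
  | succ k ih =>
    rcases List.eq_nil_or_concat h with rfl | ⟨g, ρ, rfl⟩
    · simp [PMF.mem_support_iff, histories_succ_nil]
    · rw [List.concat_eq_append, PMF.mem_support_iff, histories_succ_concat, mul_ne_zero_iff, ← PMF.mem_support_iff,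
        ← PMF.mem_support_iff, ih, follows_concat]
      simp [and_assoc]

/-! ### Probabilities of events about histories -/

theorem prob_mono {proc : V ≃ Fin n} {adv : Adversary N A} {k : ℕ} {E F : Set (List (Round A))}
    (h : ∀ l ∈ (histories proc adv k).support, l ∈ E → l ∈ F) :
    prob proc adv k E ≤ prob proc adv k F :=
  PMF.toOuterMeasure_mono _ fun l hl => h l hl.2 hl.1

theorem prob_add_compl (proc : V ≃ Fin n) (adv : Adversary N A) (k : ℕ)
    (E : Set (List (Round A))) : prob proc adv k E + prob proc adv k Eᶜ = 1 := by
  rw [prob, prob, PMF.toOuterMeasure_apply, PMF.toOuterMeasure_apply, ← ENNReal.tsum_add,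
    ← (histories proc adv k).tsum_coe]
  exact tsum_congr fun l => by
    rw [← Pi.add_apply, Set.indicator_self_add_compl]

/-- An event that cannot be undone by further rounds becomes more likely with time. -/
theorem prob_le_prob_of_le {proc : V ≃ Fin n} {adv : Adversary N A} {E : Set (List (Round A))}
    (hE : ∀ h ∈ E, ∀ ρ, h ++ [ρ] ∈ E) {k l : ℕ} (hkl : k ≤ l) :
    prob proc adv k E ≤ prob proc adv l E := by
  induction l, hkl using Nat.le_induction with
  | base => exact le_rfl
  | succ l _ ih =>
    refine ih.trans ?_
    rw [prob, prob, histories, PMF.toOuterMeasure_bind_apply, PMF.toOuterMeasure_apply]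
    refine ENNReal.tsum_le_tsum fun h => ?_
    by_cases hh : h ∈ E
    · rw [Set.indicator_of_mem hh]
      refine (mul_one _).symm.le.trans (mul_le_mul_right ?_ _)
      refine ((PMF.toOuterMeasure_apply_eq_one_iff _ _).2 ?_).ge
      intro l hl
      simp only [PMF.support_bind, Set.mem_iUnion, PMF.support_pure, Set.mem_singleton_iff] at hl
      obtain ⟨ρ, -, rfl⟩ := hl
      exact hE h hh ρ
    · rw [Set.indicator_of_notMem hh]
      exact zero_le

/-! ## Executions -/

theorem current_range_succ (e : ℕ → Round A) (t : ℕ) :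
    A.current ((List.range (t + 1)).map e) = (e t).final := by
  rw [List.range_succ, List.map_append]
  exact current_concat _ _

theorem getElem?_map_range {α : Type*} {e : ℕ → α} {t s : ℕ} {a : α} :
    ((List.range t).map e)[s]? = some a ↔ s < t ∧ e s = a := by
  simp only [List.getElem?_map, Option.map_eq_some_iff]
  constructor
  · rintro ⟨b, hb, rfl⟩
    obtain ⟨hs, hb⟩ := List.getElem?_eq_some_iff.1 hb
    simp at hs hb
    subst hb
    exact ⟨hs, rfl⟩
  · rintro ⟨hs, rfl⟩
    exact ⟨s, by simp [hs], rfl⟩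

theorem IsExecution.bcast_eq {proc : V ≃ Fin n} {adv : Adversary N A} {e : ℕ → Round A}
    (he : IsExecution proc adv e)
    (t : ℕ) : (e t).bcast = adv.bcast ((List.range t).map e) :=
  (mem_support_nextRound.1 (he t)).1

theorem bcast_unique {proc : V ≃ Fin n} {adv : Adversary N A} {e : ℕ → Round A}
    (hadv : adv.WellFormed proc)
    (he : IsExecution proc adv e) {r s : ℕ} {u w : V} {m : M} (hr : (e r).Bcast u m)
    (hs : (e s).Bcast w m) : r = s ∧ u = w := by
  have key : ∀ {r s : ℕ} {u w : V}, (e r).Bcast u m → (e s).Bcast w m → ¬ r < s := by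
    intro r s u w hr hs hlt
    rw [Round.Bcast, he.bcast_eq s] at hs
    exact (hadv _ _ _ hs).1 (e r) (List.mem_map.2 ⟨r, by simpa using hlt, rfl⟩) u hr
  have hrs : r = s := le_antisymm (not_lt.1 (key hs hr)) (not_lt.1 (key hr hs))
  subst hrs
  rw [Round.Bcast, he.bcast_eq r] at hr hs
  exact ⟨rfl, (hadv _ _ _ hs).2.1 u hr⟩

theorem exists_ack_of_bcast {proc : V ≃ Fin n} {adv : Adversary N A} {e : ℕ → Round A}
    (hadv : adv.WellFormed proc)
    (he : IsExecution proc adv e) {s t : ℕ} {u : V} {m m' : M} (ht : (e t).Bcast u m)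
    (hs : (e s).Bcast u m') (hst : s < t) : ∃ s', s ≤ s' ∧ s' < t ∧ (e s').Ack proc u m' := by
  rw [Round.Bcast, he.bcast_eq t] at ht
  obtain ⟨s', ρ', h1, h2, h3⟩ :=
    (hadv _ _ _ ht).2.2 s (e s) m' (getElem?_map_range.2 ⟨hst, rfl⟩) hs
  obtain ⟨h4, rfl⟩ := getElem?_map_range.1 h2
  exact ⟨s', h1, h4, h3⟩

/-! ## Receptions -/

theorem reception_sent {P : Type} {R : SimpleGraph V} {tr : V → Option P} {v : V} {p : P}
    (h : tr v = some p) : reception R tr v = .sent p := by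
  unfold reception
  rw [h]

theorem reception_received {P : Type} {R : SimpleGraph V} {tr : V → Option P} {u v : V} {p : P}
    (hv : tr v = none) (hu : tr u = some p) (hR : R.Adj u v)
    (huniq : ∀ w, R.Adj w v → (tr w).isSome → w = u) : reception R tr v = .received p := by
  have hex : ∃! u, R.Adj u v ∧ (tr u).isSome :=
    ⟨u, ⟨hR, by simp [hu]⟩, fun w hw => huniq w hw.1 hw.2⟩
  have hc : hex.choose = u := huniq _ hex.choose_spec.1.1 hex.choose_spec.1.2
  unfold reception
  rw [hv]
  simp only [hex, dite_true]
  have key : ∀ w (hw : (tr w).isSome), w = u → (tr w).get hw = p := by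
    rintro w hw rfl
    simp [hu]
  rw [key _ _ hc]

theorem reception_silence {P : Type} {R : SimpleGraph V} {tr : V → Option P} {v : V}
    (hv : tr v = none) (h : ¬ ∃! u, R.Adj u v ∧ (tr u).isSome) :
    reception R tr v = .silence := by
  unfold reception
  rw [hv]
  simp only [h, dite_false]

theorem reception_cases {P : Type} (R : SimpleGraph V) (tr : V → Option P) (v : V) :
    (∃ p, tr v = some p ∧ reception R tr v = .sent p) ∨
    (∃ u p, tr v = none ∧ tr u = some p ∧ R.Adj u v ∧
      (∀ w, R.Adj w v → (tr w).isSome → w = u) ∧ reception R tr v = .received p) ∨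
    (tr v = none ∧ (¬ ∃! u, R.Adj u v ∧ (tr u).isSome) ∧ reception R tr v = .silence) := by
  cases hv : tr v with
  | some p => exact Or.inl ⟨p, rfl, reception_sent hv⟩
  | none =>
    by_cases hex : ∃! u, R.Adj u v ∧ (tr u).isSome
    · obtain ⟨u, ⟨huR, hu⟩, huniq⟩ := hex
      obtain ⟨p, hp⟩ := Option.isSome_iff_exists.1 hu
      have huniq' : ∀ w, R.Adj w v → (tr w).isSome → w = u := fun w h1 h2 => huniq w ⟨h1, h2⟩
      exact Or.inr (Or.inl ⟨u, p, rfl, hp, huR, huniq', reception_received hv hp huR huniq'⟩)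
    · exact Or.inr (Or.inr ⟨rfl, hex, reception_silence hv hex⟩)

/-- Receptions only depend on the links from transmitting nodes. -/
theorem reception_congr {W P : Type} (e : V ≃ W) {R : SimpleGraph V} {R' : SimpleGraph W}
    {tr : W → Option P} {v : V}
    (h : ∀ u, (tr (e u)).isSome → (R.Adj u v ↔ R'.Adj (e u) (e v))) :
    reception R (fun u => tr (e u)) v = reception R' tr (e v) := by
  rcases reception_cases R (fun u => tr (e u)) v with
    ⟨p, hp, hr⟩ | ⟨u, p, hv, hu, hR, huniq, hr⟩ | ⟨hv, hne, hr⟩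
  · rw [hr, reception_sent hp]
  · rw [hr]
    refine (reception_received hv hu ((h u (by simp [hu])).1 hR) ?_).symm
    intro w hw hws
    obtain ⟨w, rfl⟩ := e.surjective w
    rw [huniq w ((h w hws).2 hw) hws]
  · rw [hr]
    refine (reception_silence hv fun hex => hne ?_).symm
    obtain ⟨w, ⟨hw, hws⟩, huniq⟩ := hex
    obtain ⟨w, rfl⟩ := e.surjective w
    refine ⟨w, ⟨(h w hws).2 hw, hws⟩, fun x hx => e.injective ?_⟩
    exact huniq _ ⟨(h x hx.2).1 hx.1, hx.2⟩

end General

/-! ## The centralized algorithm -/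

/-- The nodes take turns in transmitting their pending message, which they acknowledge
immediately. Whose turn it is depends on the round counter of the process at the node `0`. -/
noncomputable def roundRobin (n : ℕ) [NeZero n] (M : Type) : CentralizedAlgorithm (Fin n) n M where
  Packet := M
  State _ := Option M × ℕ
  init _ := (none, 0)
  step _ s inp := PMF.pure (inp.or s.1, s.2)
  packet _ s := s.1
  recv _ s r := PMF.pure <|
    match r with
    | .sent p => ((none, s.2 + 1), some p, ∅)
    | .received p => ((s.1, s.2 + 1), none, {p})
    | .silence => ((s.1, s.2 + 1), none, ∅)
  permit proc states _ i := (proc.symm i).val = (states (proc 0)).2 % n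

/-! ### Analysis of a single round-robin round -/

section RoundRobin

variable {n : ℕ} [NeZero n] {M : Type} {N : DualGraph (Fin n)} {proc : Fin n ≃ Fin n}
  {adv : Adversary N (roundRobin n M)} {h : List (Round (roundRobin n M))}
  {ρ : Round (roundRobin n M)}

theorem roundRobin_mid (hρ : ρ ∈ (nextRound proc adv h).support) (i : Fin n) :
    ρ.mid i = ((ρ.bcast (proc.symm i)).or ((roundRobin n M).current h i).1,
      ((roundRobin n M).current h i).2) := by
  obtain ⟨h1, h2, -⟩ := mem_support_nextRound.1 hρ
  rw [h1]
  exact (PMF.mem_support_pure_iff _ _).1 (h2 i)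

theorem roundRobin_recv_sent {i : Fin n} {s : Option M × ℕ} {p : M}
    {x : (Option M × ℕ) × Option M × Finset M}
    (hx : x ∈ ((roundRobin n M).recv i s (.sent p)).support) : x = ((none, s.2 + 1), some p, ∅) :=
  (PMF.mem_support_pure_iff _ _).1 hx

theorem roundRobin_recv_received {i : Fin n} {s : Option M × ℕ} {p : M}
    {x : (Option M × ℕ) × Option M × Finset M}
    (hx : x ∈ ((roundRobin n M).recv i s (.received p)).support) :
    x = ((s.1, s.2 + 1), none, {p}) :=
  (PMF.mem_support_pure_iff _ _).1 hx

theorem roundRobin_recv_silence {i : Fin n} {s : Option M × ℕ}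
    {x : (Option M × ℕ) × Option M × Finset M}
    (hx : x ∈ ((roundRobin n M).recv i s .silence).support) : x = ((s.1, s.2 + 1), none, ∅) :=
  (PMF.mem_support_pure_iff _ _).1 hx

/-- The node whose turn it is. -/
def turn (proc : Fin n ≃ Fin n) (ρ : Round (roundRobin n M)) : Fin n :=
  ⟨(ρ.mid (proc 0)).2 % n, Nat.mod_lt _ (NeZero.pos n)⟩

theorem roundRobin_transmission (proc : Fin n ≃ Fin n) (ρ : Round (roundRobin n M))
    (inp : Fin n → Option M) (v : Fin n) :
    (roundRobin n M).transmission proc inp ρ.mid v =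
      if v = turn proc ρ then (ρ.mid (proc v)).1 else none := by
  simp [CentralizedAlgorithm.transmission, roundRobin, turn, Fin.ext_iff]

theorem roundRobin_turn (hρ : ρ ∈ (nextRound proc adv h).support) :
    ρ.ackOut (proc (turn proc ρ)) = (ρ.mid (proc (turn proc ρ))).1 ∧
    ρ.final (proc (turn proc ρ)) = (none, (ρ.mid (proc (turn proc ρ))).2 + 1) ∧
    ρ.rcvOut (proc (turn proc ρ)) = ∅ := by
  obtain ⟨-, -, h3⟩ := mem_support_nextRound.1 hρ
  have h3 := h3 (proc (turn proc ρ))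
  have htr := roundRobin_transmission proc ρ (adv.bcast h)
  rw [Equiv.symm_apply_apply] at h3
  rcases hm : (ρ.mid (proc (turn proc ρ))).1 with _ | m
  · rw [reception_silence] at h3
    · have h4 := roundRobin_recv_silence h3
      refine ⟨congrArg (fun x => x.2.1) h4, (congrArg Prod.fst h4).trans ?_,
        congrArg (fun x => x.2.2) h4⟩
      exact Prod.ext hm rfl
    · exact (htr _).trans ((if_pos rfl).trans hm)
    · rintro ⟨u, ⟨-, hu⟩, -⟩
      rw [htr] at hu
      split_ifs at hu with hut
      · subst hut
        exact absurd hu (by rw [hm]; exact Bool.false_ne_true)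
      · exact Bool.false_ne_true hu
  · have htm := (htr (turn proc ρ)).trans ((if_pos rfl).trans hm)
    rw [reception_sent htm] at h3
    have h4 := roundRobin_recv_sent h3
    exact ⟨congrArg (fun x => x.2.1) h4, congrArg Prod.fst h4, congrArg (fun x => x.2.2) h4⟩

/-- Only the node whose turn it is can transmit, and its `G`-links belong to every reach set. So
there are no collisions, and its pending message is certain to arrive at every `G`-neighbor. -/
theorem roundRobin_not_turn (hρ : ρ ∈ (nextRound proc adv h).support) {v : Fin n}
    (hv : v ≠ turn proc ρ) :
    ρ.ackOut (proc v) = none ∧ ρ.final (proc v) = ((ρ.mid (proc v)).1, (ρ.mid (proc v)).2 + 1) ∧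
    (∀ m, ρ.Rcv proc v m → (ρ.mid (proc (turn proc ρ))).1 = some m) ∧
    ∀ m, (ρ.mid (proc (turn proc ρ))).1 = some m → N.G.Adj (turn proc ρ) v → ρ.Rcv proc v m := by
  obtain ⟨-, -, h3⟩ := mem_support_nextRound.1 hρ
  have h3 := h3 (proc v)
  have htr := roundRobin_transmission proc ρ (adv.bcast h)
  have hlone : ∀ w, ((roundRobin n M).transmission proc (adv.bcast h) ρ.mid w).isSome →
      w = turn proc ρ := by
    intro w hw
    by_contra hne
    rw [htr, if_neg hne] at hw
    exact Bool.false_ne_true hw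
  rw [Equiv.symm_apply_apply] at h3
  rcases reception_cases (adv.reach h ρ.mid)
    ((roundRobin n M).transmission proc (adv.bcast h) ρ.mid) v with
    ⟨p, hp, hr⟩ | ⟨u, p, -, hu, hR, -, hr⟩ | ⟨hv', hne, hr⟩
  · simp [htr, hv] at hp
  · have hut := hlone u (by simp [hu])
    subst hut
    rw [htr, if_pos rfl] at hu
    rw [hr] at h3
    have h4 := roundRobin_recv_received h3
    have h5 : ρ.rcvOut (proc v) = ({(p : M)} : Finset M) := congrArg (fun x => x.2.2) h4
    refine ⟨congrArg (fun x => x.2.1) h4, congrArg Prod.fst h4, fun m hm => ?_, fun m hm _ => ?_⟩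
    · rw [Round.Rcv, h5] at hm
      rw [(Finset.mem_singleton (α := M)).1 hm]
      exact hu
    · rw [Round.Rcv, h5]
      exact (Finset.mem_singleton (α := M)).2 (Option.some_injective _ (hm.symm.trans hu))
  · rw [hr] at h3
    have h4 := roundRobin_recv_silence h3
    have h5 : ρ.rcvOut (proc v) = ∅ := congrArg (fun x => x.2.2) h4
    refine ⟨congrArg (fun x => x.2.1) h4, congrArg Prod.fst h4, fun m hm => ?_, fun m hm hG => (hne ?_).elim⟩
    · rw [Round.Rcv, h5] at hm
      simp at hm
    · refine ⟨turn proc ρ, ⟨adv.le_reach _ _ hG, ?_⟩, fun w hw => hlone w hw.2⟩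
      rw [htr, if_pos rfl]
      exact Option.isSome_iff_exists.2 ⟨m, hm⟩

theorem roundRobin_ack (hρ : ρ ∈ (nextRound proc adv h).support) {v : Fin n} {m : M} :
    ρ.Ack proc v m ↔ v = turn proc ρ ∧ (ρ.mid (proc v)).1 = some m := by
  by_cases hv : v = turn proc ρ
  · subst hv
    simp [Round.Ack, (roundRobin_turn hρ).1]
  · simp [Round.Ack, (roundRobin_not_turn hρ hv).1, hv]

theorem roundRobin_rcv (hρ : ρ ∈ (nextRound proc adv h).support) {v : Fin n} {m : M}
    (hr : ρ.Rcv proc v m) : v ≠ turn proc ρ ∧ ρ.Ack proc (turn proc ρ) m := by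
  by_cases hv : v = turn proc ρ
  · subst hv
    simp [Round.Rcv, (roundRobin_turn hρ).2.2] at hr
  · exact ⟨hv, (roundRobin_ack hρ).2 ⟨rfl, (roundRobin_not_turn hρ hv).2.2.1 m hr⟩⟩

theorem roundRobin_rcv_of_ack (hρ : ρ ∈ (nextRound proc adv h).support) {u v : Fin n} {m : M}
    (ha : ρ.Ack proc u m) (hG : N.G.Adj u v) : ρ.Rcv proc v m := by
  obtain ⟨rfl, hm⟩ := (roundRobin_ack hρ).1 ha
  exact (roundRobin_not_turn hρ hG.ne').2.2.2 m hm hG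

theorem roundRobin_final (hρ : ρ ∈ (nextRound proc adv h).support) (v : Fin n) :
    ρ.final (proc v) = (if v = turn proc ρ then none else (ρ.mid (proc v)).1,
      (ρ.mid (proc v)).2 + 1) := by
  split_ifs with hv
  · subst hv
    exact (roundRobin_turn hρ).2.1
  · exact (roundRobin_not_turn hρ hv).2.1

/-! ### Executions -/

variable {e : ℕ → Round (roundRobin n M)}

theorem roundRobin_counter (he : IsExecution proc adv e) (t : ℕ) (i : Fin n) :
    ((e t).mid i).2 = t := by
  induction t with
  | zero =>
    rw [roundRobin_mid (he 0)]
    rfl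
  | succ t ih =>
    rw [roundRobin_mid (he (t + 1)), current_range_succ]
    obtain ⟨v, rfl⟩ := proc.surjective i
    rw [roundRobin_final (he t), ih]

theorem roundRobin_turn_val (he : IsExecution proc adv e) (t : ℕ) :
    (turn proc (e t)).val = t % n := by
  simp [turn, roundRobin_counter he]

theorem roundRobin_pending_zero (he : IsExecution proc adv e) (v : Fin n) :
    ((e 0).mid (proc v)).1 = (e 0).bcast v := by
  rw [roundRobin_mid (he 0)]
  refine (Option.or_none (o := (e 0).bcast (proc.symm (proc v)))).trans ?_
  rw [Equiv.symm_apply_apply]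

theorem roundRobin_pending_succ (he : IsExecution proc adv e) (t : ℕ) (v : Fin n) :
    ((e (t + 1)).mid (proc v)).1 = ((e (t + 1)).bcast v).or
      (if v = turn proc (e t) then none else ((e t).mid (proc v)).1) := by
  rw [roundRobin_mid (he (t + 1)), current_range_succ, roundRobin_final (he t)]
  simp

/-- A pending message is one that was broadcast and is still to be acknowledged. -/
theorem roundRobin_pending_sound (hadv : adv.WellFormed proc) (he : IsExecution proc adv e)
    {t : ℕ} {v : Fin n} {m : M} (hm : ((e t).mid (proc v)).1 = some m) :
    (∃ r ≤ t, (e r).Bcast v m) ∧ ∀ s < t, ¬ (e s).Ack proc v m := by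
  induction t with
  | zero =>
    rw [roundRobin_pending_zero he] at hm
    exact ⟨⟨0, le_rfl, hm⟩, fun s hs => absurd hs (Nat.not_lt_zero s)⟩
  | succ t ih =>
    rw [roundRobin_pending_succ he] at hm
    rcases hb : (e (t + 1)).bcast v with _ | m'
    · rw [hb, Option.none_or] at hm
      split_ifs at hm with hv
      obtain ⟨⟨r, hr, hrb⟩, ha⟩ := ih hm
      refine ⟨⟨r, by omega, hrb⟩, fun s hs => ?_⟩
      rcases Nat.lt_succ_iff_lt_or_eq.1 hs with hs | rfl
      · exact ha s hs
      · rw [roundRobin_ack (he s)]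
        exact fun h => hv h.1
    · rw [hb, Option.some_or, Option.some.injEq] at hm
      subst hm
      refine ⟨⟨t + 1, le_rfl, hb⟩, ?_⟩
      -- A fresh message cannot have been pending before: tracing it back would give a second
      -- `bcast` of the same message.
      have hack : ∀ s ≤ t, ((e s).mid (proc v)).1 ≠ some m' := by
        intro s
        induction s with
        | zero =>
          intro _ h0
          rw [roundRobin_pending_zero he] at h0
          have := (bcast_unique hadv he (show (e 0).Bcast v m' from h0) hb).1
          omega
        | succ s ihs =>
          intro hs h0
          rw [roundRobin_pending_succ he, Option.or_eq_some_iff] at h0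
          rcases h0 with h0 | ⟨-, h0⟩
          · have := (bcast_unique hadv he (show (e (s + 1)).Bcast v m' from h0) hb).1
            omega
          · split_ifs at h0
            exact ihs (by omega) h0
      intro s hs h
      exact hack s (by omega) ((roundRobin_ack (he s)).1 h).2

/-- A new input would overwrite the pending message, but a well-formed environment supplies one only
after the acknowledgment. -/
theorem roundRobin_pending_complete (hadv : adv.WellFormed proc) (he : IsExecution proc adv e)
    {r t : ℕ} {v : Fin n} {m : M} (hr : (e r).Bcast v m) (hrt : r ≤ t)
    (hack : ∀ s < t, r ≤ s → ¬ (e s).Ack proc v m) : ((e t).mid (proc v)).1 = some m := by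
  induction t, hrt using Nat.le_induction with
  | base =>
    cases r with
    | zero => exact (roundRobin_pending_zero he v).trans hr
    | succ r => rw [roundRobin_pending_succ he, show (e (r + 1)).bcast v = some m from hr]; rfl
  | succ t hrt ih =>
    have ih := ih fun s hs => hack s (by omega)
    rw [roundRobin_pending_succ he]
    rcases hb : (e (t + 1)).bcast v with _ | m'
    · rw [Option.none_or, if_neg, ih]
      exact fun hv => hack t (by omega) hrt ((roundRobin_ack (he t)).2 ⟨hv, ih⟩)
    · obtain ⟨s, hs1, hs2, hs3⟩ := exists_ack_of_bcast hadv he hb hr (by omega)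
      exact (hack s hs2 hs1 hs3).elim

theorem roundRobin_ack_sound (hadv : adv.WellFormed proc) (he : IsExecution proc adv e)
    {t : ℕ} {v : Fin n} {m : M} (hm : (e t).Ack proc v m) :
    (∃ r ≤ t, (e r).Bcast v m) ∧ ∀ s < t, ¬ (e s).Ack proc v m :=
  roundRobin_pending_sound hadv he ((roundRobin_ack (he t)).1 hm).2

theorem roundRobin_goodAcks (hadv : adv.WellFormed proc) (he : IsExecution proc adv e) :
    GoodAcks proc e := by
  refine ⟨?_, fun r' u m h => (roundRobin_ack_sound hadv he h).1⟩
  rintro u m ⟨r, hr⟩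
  have hex : ∃ t, (e t).Ack proc u m := by
    by_contra! hno
    -- Round `n * r + u` is a turn of `u` that does not precede `r`.
    have hle : r ≤ n * r + u.val :=
      (Nat.le_mul_of_pos_left r (NeZero.pos n)).trans (Nat.le_add_right _ _)
    refine hno (n * r + u.val) ((roundRobin_ack (he _)).2 ⟨Fin.ext ?_, ?_⟩)
    · rw [roundRobin_turn_val he, Nat.mul_add_mod, Nat.mod_eq_of_lt u.isLt]
    · exact roundRobin_pending_complete hadv he hr hle fun s _ _ => hno s
  obtain ⟨t, ht⟩ := hex
  refine ⟨t, ht, fun s hs => le_antisymm ?_ ?_⟩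
  · exact not_lt.1 fun hlt => (roundRobin_ack_sound hadv he hs).2 t hlt ht
  · exact not_lt.1 fun hlt => (roundRobin_ack_sound hadv he ht).2 s hlt hs

/-- Every `rcv` output coincides with the `ack` of the same message at the node whose turn it is, so
uniqueness is inherited from the acknowledgments. Completeness of `G'` makes that node a
`G'`-neighbor. -/
theorem roundRobin_goodRcvs (hN : N.G' = ⊤) (hadv : adv.WellFormed proc)
    (he : IsExecution proc adv e) : GoodRcvs N proc e := by
  constructor
  · intro v m r₁ r₂ h₁ h₂
    have a₁ := (roundRobin_rcv (he r₁) h₁).2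
    have a₂ := (roundRobin_rcv (he r₂) h₂).2
    obtain ⟨⟨s₁, -, b₁⟩, c₁⟩ := roundRobin_ack_sound hadv he a₁
    obtain ⟨⟨s₂, -, b₂⟩, c₂⟩ := roundRobin_ack_sound hadv he a₂
    have hu := (bcast_unique hadv he b₁ b₂).2
    rw [hu] at a₁ c₁
    exact le_antisymm (not_lt.1 fun hlt => c₁ _ hlt a₂) (not_lt.1 fun hlt => c₂ _ hlt a₁)
  · intro v m r hr
    obtain ⟨hne, ha⟩ := roundRobin_rcv (he r) hr
    refine ⟨turn proc (e r), ?_, roundRobin_ack_sound hadv he ha⟩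
    rw [hN]
    exact hne

theorem roundRobin_solves (hN : N.G' = ⊤) : SolvesLocalBroadcast N (roundRobin n M) := by
  intro proc adv hadv
  refine ⟨fun e he => ⟨roundRobin_goodAcks hadv he, roundRobin_goodRcvs hN hadv he⟩, ?_⟩
  intro u m k
  -- A message is delivered to all `G`-neighbors in the very round of its `ack`, so no possible
  -- history is a failure.
  refine (prob_mono (F := ∅) fun h hh hE => ?_).trans (by simp [prob])
  obtain ⟨r, r', ρ, ρ', hrr, -, hρ', -, ha, v, hG, hv⟩ := hE
  obtain ⟨hlt, rfl⟩ := List.getElem?_eq_some_iff.1 hρ'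
  exact hv r' _ hrr le_rfl hρ'
    (roundRobin_rcv_of_ack ((mem_support_histories.1 hh).2.getElem r' hlt) ha hG)

end RoundRobin

/-! ### Progress in the spread network -/

theorem spreadG_adj {n : ℕ} {u v : Fin n} : (spreadG n).Adj u v ↔
    (u.val < n / 2 ∧ n / 2 ≤ v.val ∧ (v.val = n / 2 + u.val ∨ u.val = 0)) ∨
    (v.val < n / 2 ∧ n / 2 ≤ u.val ∧ (u.val = n / 2 + v.val ∨ v.val = 0)) := by
  rw [spreadG, SimpleGraph.fromRel_adj, and_iff_right_of_imp]
  rintro h rfl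
  omega

theorem mem_receivers_spread {n : ℕ} (hn : 2 ≤ n) {v : Fin n} :
    v ∈ receivers (spreadNetwork n) (broadcasters n) ↔ n / 2 ≤ v.val := by
  simp only [receivers, broadcasters, Finset.mem_filter, Finset.mem_univ, true_and,
    spreadNetwork, spreadG_adj]
  constructor
  · rintro ⟨u, hu, h | h⟩ <;> omega
  · intro hv
    exact ⟨⟨0, by omega⟩, by simp; omega, Or.inl ⟨by simp; omega, hv, Or.inr rfl⟩⟩

theorem maxDegree'_spread {n : ℕ} (hn : 2 ≤ n) : (spreadNetwork n).maxDegree' = n - 1 := by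
  have key : ∀ v : Fin n, ((spreadNetwork n).G'.neighborSet v).ncard = n - 1 := by
    intro v
    have : (spreadNetwork n).G'.neighborSet v = {v}ᶜ := by
      ext w
      simp [spreadNetwork, eq_comm]
    rw [this, Set.ncard_compl, Set.ncard_singleton, Nat.card_eq_fintype_card, Fintype.card_fin]
  have : Nonempty (Fin n) := ⟨⟨0, by omega⟩⟩
  rw [DualGraph.maxDegree', Finset.sup_congr rfl fun v _ => key v,
    Finset.sup_const Finset.univ_nonempty]

theorem roundRobin_progress {n : ℕ} [NeZero n] {M : Type} (hn : 2 ≤ n) :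
    HasAverageProgress (spreadNetwork n) (broadcasters n) (roundRobin n M) 1 := by
  intro proc adv _ hb
  -- One round suffices, and the event then has probability one.
  refine le_trans tsub_le_self (le_trans ?_ (le_iSup _ 1))
  refine ((PMF.toOuterMeasure_apply_eq_one_iff _ _).2 ?_).ge
  intro h hh
  obtain ⟨hlen, hf⟩ := mem_support_histories.1 hh
  obtain ⟨ρ, rfl⟩ := List.length_eq_one_iff.1 hlen
  have hρ : ρ ∈ (nextRound proc adv []).support := hf [] ρ (List.prefix_refl _)
  have hzero : (0 : Fin n).val = 0 := rfl
  have hturn : turn proc ρ = 0 := by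
    apply Fin.ext
    have h2 : (ρ.mid (proc 0)).2 = 0 := by
      rw [roundRobin_mid hρ]
      rfl
    rw [turn, hzero]
    exact (congrArg (· % n) h2).trans (Nat.zero_mod n)
  obtain ⟨m, hm⟩ := Option.isSome_iff_exists.1 ((hb 0).2 (by simp [broadcasters]; omega))
  have hack : ρ.Ack proc 0 m := by
    rw [roundRobin_ack hρ, hturn]
    refine ⟨rfl, ?_⟩
    rw [roundRobin_mid hρ, (mem_support_nextRound.1 hρ).1, Equiv.symm_apply_apply, hm]
    rfl
  have hfirst : ∀ v ∈ receivers (spreadNetwork n) (broadcasters n),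
      (firstReceive proc [ρ] v : ℝ≥0∞) ≤ 1 := by
    intro v hv
    rw [mem_receivers_spread hn] at hv
    have hadj : (spreadNetwork n).G.Adj 0 v :=
      spreadG_adj.2 (Or.inl ⟨by omega, hv, Or.inr rfl⟩)
    have h1 : firstReceive proc [ρ] v ≤ 1 :=
      iInf₂_le_of_le 0 ⟨ρ, rfl, m, roundRobin_rcv_of_ack hρ hack hadj⟩ (by simp)
    exact_mod_cast h1
  show averageProgress _ _ _ _ ≤ _
  rw [averageProgress]
  refine (ENNReal.div_le_div_right (Finset.sum_le_sum hfirst) _).trans ?_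
  simp [ENNReal.div_self_le_one]

/-! ## Lone transmitters -/

/-- `u` is the only transmitter. -/
def Lone {ι P : Type} (tr : ι → Option P) (u : ι) : Prop :=
  (tr u).isSome ∧ ∀ w, (tr w).isSome → w = u

theorem lone_comp {ι κ P : Type} (e : κ ≃ ι) {tr : ι → Option P} {u : κ} :
    Lone (fun v => tr (e v)) u ↔ Lone tr (e u) :=
  ⟨fun h => ⟨h.1, fun w hw => by
    rw [← h.2 (e.symm w) (by simpa using hw), e.apply_symm_apply]⟩,
    fun h => ⟨h.1, fun w hw => e.injective (h.2 _ hw)⟩⟩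

/-- What a process gets that does not hear any other process. -/
def ownReception {P : Type} : Option P → Reception P
  | some p => .sent p
  | none => .silence

theorem reception_eq_own {V P : Type} {R : SimpleGraph V} {tr : V → Option P} {v : V}
    (h : tr v = none → ¬ ∃! u, R.Adj u v ∧ (tr u).isSome) :
    reception R tr v = ownReception (tr v) := by
  rcases hv : tr v with _ | p
  · exact reception_silence hv (h hv)
  · exact reception_sent hv

section Distributed

variable {V : Type} {n : ℕ} {M : Type} {A : CentralizedAlgorithm V n M}

/-- The packet, if any, that is transmitted by each process. -/
def CentralizedAlgorithm.signal (A : CentralizedAlgorithm V n M) (s : ∀ i, A.State i) (i : Fin n) :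
    Option A.Packet := A.packet i (s i)

/-- The processes are free to transmit whenever they want. -/
def CentralizedAlgorithm.Unrestricted (A : CentralizedAlgorithm V n M) : Prop :=
  ∀ proc states inputs i, A.permit proc states inputs i

theorem DistributedAlgorithm.unrestricted_toCentralized (A : DistributedAlgorithm n M) :
    (A.toCentralized V).Unrestricted :=
  fun _ _ _ _ => trivial

theorem CentralizedAlgorithm.Unrestricted.transmission (hA : A.Unrestricted) (proc : V ≃ Fin n)
    (inp : V → Option M) (s : ∀ i, A.State i) :
    A.transmission proc inp s = fun v => A.signal s (proc v) := by
  funext v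
  exact if_pos (hA _ _ _ _)

-- Each round has at most one lone transmitter. This count serves the averaging over `j`, the bound
-- on the receivers that hear something, and the choice of a process that is never alone.
open Classical in
theorem card_lone_le (h : List (Round A)) :
    (Finset.univ.filter fun i => ∃ ρ ∈ h, Lone (A.signal ρ.mid) i).card ≤ h.length := by
  induction h with
  | nil => simp
  | cons ρ h ih =>
    have hsub : (Finset.univ.filter fun i => ∃ σ ∈ ρ :: h, Lone (A.signal σ.mid) i) ⊆
        (Finset.univ.filter fun i => Lone (A.signal ρ.mid) i) ∪
        Finset.univ.filter fun i => ∃ σ ∈ h, Lone (A.signal σ.mid) i := by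
      intro i
      simp
    have hone : (Finset.univ.filter fun i => Lone (A.signal ρ.mid) i).card ≤ 1 := by
      rw [Finset.card_le_one]
      intro a ha b hb
      simp only [Finset.mem_filter, Finset.mem_univ, true_and] at ha hb
      exact hb.2 a ha.1
    have := (Finset.card_le_card hsub).trans (Finset.card_union_le _ _)
    simp only [List.length_cons]
    omega

/-! ## Processes that hear nothing do not output anything -/

/-- All links work, unless some process other than `q` transmits alone: then
those at `q` fail. -/
def avoiding {ι P : Type} (tr : ι → Option P) (q : ι) : SimpleGraph ι where
  Adj u v := u ≠ v ∧ ((∃ w, w ≠ q ∧ Lone tr w) → u ≠ q ∧ v ≠ q)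
  symm := ⟨fun _ _ h => ⟨h.1.symm, fun hw => (h.2 hw).symm⟩⟩
  loopless := ⟨fun _ h => h.1 rfl⟩

/-- If the links at a listening `q` work, no other process transmits alone, so `q` is adjacent
either to no transmitter or to at least two. -/
theorem reception_avoiding {ι P : Type} (tr : ι → Option P) (q : ι) :
    reception (avoiding tr q) tr q = ownReception (tr q) := by
  refine reception_eq_own fun hq => ?_
  rintro ⟨u, ⟨hu, hus⟩, huniq⟩
  by_cases hlone : ∃ w, w ≠ q ∧ Lone tr w
  · exact (hu.2 hlone).2 rfl
  · refine hlone ⟨u, hu.1, hus, fun w hws => huniq w ⟨⟨?_, fun h => (hlone h).elim⟩, hws⟩⟩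
    rintro rfl
    simp [hq] at hws

/-- The possible next rounds, as far as the process `q` is concerned, when it gets no
input and does not hear any other process. -/
def silentNext (A : CentralizedAlgorithm V n M) (q : Fin n)
    (h : List (Round A)) : Set (Round A) :=
  {ρ | ρ.mid q ∈ (A.step q (A.current h q) none).support ∧
    (ρ.final q, ρ.ackOut q, ρ.rcvOut q) ∈
      (A.recv q (ρ.mid q) (ownReception (A.signal ρ.mid q))).support}

/-- The possible next rounds when there are no inputs and the links are those of `avoiding`. -/
def avoidingNext (A : CentralizedAlgorithm V n M) (q : Fin n)
    (h : List (Round A)) : Set (Round A) :=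
  {ρ | ρ.bcast = (fun _ => none) ∧
    (∀ i, ρ.mid i ∈ (A.step i (A.current h i) none).support) ∧
    ∀ i, (ρ.final i, ρ.ackOut i, ρ.rcvOut i) ∈ (A.recv i (ρ.mid i)
      (reception (avoiding (A.signal ρ.mid) q) (A.signal ρ.mid) i)).support}

/-- Only the `q`-component of `h` is kept; the other processes are rerun without inputs, with
arbitrary possible transitions. This is consistent because under `avoiding` the reception of `q`
depends only on its own transmission. -/
theorem exists_avoiding_history {q : Fin n} {h : List (Round A)}
    (hh : Follows (silentNext A q) h) :
    ∃ g, Follows (avoidingNext A q) g ∧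
      A.current g q = A.current h q ∧
      g.map (fun ρ => ρ.rcvOut q) = h.map (fun ρ => ρ.rcvOut q) := by
  classical
  induction h using List.reverseRecOn with
  | nil => exact ⟨[], follows_nil _, rfl, rfl⟩
  | append_singleton h ρ ih =>
    obtain ⟨hh, hρ⟩ := follows_concat.1 hh
    obtain ⟨g, hg, hcur, hmap⟩ := ih hh
    let mid : ∀ i, A.State i := Function.update
      (fun i => (A.step i (A.current g i) none).support_nonempty.some) q (ρ.mid q)
    have hmidq : mid q = ρ.mid q := Function.update_self ..
    let out : ∀ i, A.State i × Option M × Finset M := Function.update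
      (fun i => (A.recv i (mid i)
        (reception (avoiding (A.signal mid) q) (A.signal mid) i)).support_nonempty.some) q
      (ρ.final q, ρ.ackOut q, ρ.rcvOut q)
    have houtq : out q = (ρ.final q, ρ.ackOut q, ρ.rcvOut q) := Function.update_self ..
    refine ⟨g ++ [⟨fun _ => none, mid, fun i => (out i).1, fun i => (out i).2.1,
      fun i => (out i).2.2⟩], follows_concat.2 ⟨hg, rfl, fun i => ?_, fun i => ?_⟩, ?_, ?_⟩
    · by_cases hi : i = q
      · subst hi
        show mid i ∈ _
        rw [hmidq, hcur]
        exact hρ.1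
      · show mid i ∈ _
        rw [show mid i = _ from Function.update_of_ne hi ..]
        exact (A.step i (A.current g i) none).support_nonempty.some_mem
    · show out i ∈ (A.recv i (mid i)
        (reception (avoiding (A.signal mid) q) (A.signal mid) i)).support
      by_cases hi : i = q
      · subst hi
        have hs : A.signal mid i = A.signal ρ.mid i := by
          rw [CentralizedAlgorithm.signal, hmidq, CentralizedAlgorithm.signal]
        rw [reception_avoiding, houtq, hs, hmidq]
        exact hρ.2
      · rw [show out i = _ from Function.update_of_ne hi ..]
        exact PMF.support_nonempty _ |>.some_mem
    · rw [current_concat, current_concat]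
      exact congrArg Prod.fst houtq
    · rw [List.map_append, List.map_append, hmap]
      simp [houtq]

/-- The adversary of the spread network without inputs that uses the links of `avoiding`. -/
def avoidingAdversary (A : CentralizedAlgorithm (Fin n) n M) (proc : Fin n ≃ Fin n) (q : Fin n) :
    Adversary (spreadNetwork n) A where
  bcast _ _ := none
  reach _ s := spreadG n ⊔ (avoiding (A.signal s) q).comap proc
  le_reach _ _ := le_sup_left
  reach_le _ _ := le_top

theorem exists_equiv_apply_eq {a b q x : Fin n} (hab : a ≠ b) (hqx : q ≠ x) :
    ∃ e : Fin n ≃ Fin n, e a = q ∧ e b = x := by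
  refine ⟨(Equiv.swap a q).trans (Equiv.swap (Equiv.swap a q b) x), ?_, by simp⟩
  rw [Equiv.trans_apply, Equiv.swap_apply_left, Equiv.swap_apply_of_ne_of_ne _ hqx]
  intro h
  have := (Equiv.swap a q).injective (by rw [Equiv.swap_apply_left]; exact h : _ = Equiv.swap a q b)
  exact hab this

/-- A process that gets no input and does not hear any other process in the first `n / 4` rounds
cannot output messages in these rounds: it may be in a network without any inputs. -/
theorem rcvOut_eq_empty_of_silent {A : CentralizedAlgorithm (Fin n) n M} (hun : A.Unrestricted)
    (hn : 4 ≤ n)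
    (hA : SolvesOneShot (spreadNetwork n) A) {q : Fin n}
    {h : List (Round A)} (hlen : h.length ≤ n / 4)
    (hh : Follows (silentNext A q) h) : ∀ ρ ∈ h, ρ.rcvOut q = ∅ := by
  classical
  obtain ⟨g, hg, -, hmap⟩ := exists_avoiding_history hh
  have hglen : g.length = h.length := by
    simpa using congrArg List.length hmap
  suffices hsuff : ∀ ρ ∈ g, ρ.rcvOut q = ∅ by
    intro ρ hρ
    have hmem : ρ.rcvOut q ∈ h.map (fun ρ => ρ.rcvOut q) := List.mem_map_of_mem hρ
    rw [← hmap] at hmem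
    obtain ⟨σ, hσ, hσρ⟩ := List.mem_map.1 hmem
    rw [← hσρ]
    exact hsuff σ hσ
  -- At most `n / 4` processes are ever alone in `g`, and together with `q` they do not exhaust all
  -- `n`.
  obtain ⟨x, hx⟩ : ∃ x, x ∉ insert q
      (Finset.univ.filter fun i => ∃ ρ ∈ g, Lone (A.signal ρ.mid) i) := by
    by_contra! hall
    have h1 := Finset.card_le_card (fun y _ => hall y : Finset.univ ⊆ _)
    have h2 := Finset.card_insert_le q
      (Finset.univ.filter fun i => ∃ ρ ∈ g, Lone (A.signal ρ.mid) i)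
    have h3 := card_lone_le g
    rw [Finset.card_univ, Fintype.card_fin] at h1
    omega
  simp only [Finset.mem_insert, Finset.mem_filter, Finset.mem_univ, true_and, not_or,
    not_exists, not_and] at hx
  -- Node `1` has the single `G`-neighbor `n / 2 + 1`. With `q` at the former and `x` at the latter,
  -- the only link to `q` that cannot be cut never carries a lone transmission.
  let b : Fin n := ⟨1, by omega⟩
  let r : Fin n := ⟨n / 2 + 1, by omega⟩
  obtain ⟨proc, hb, hr⟩ := exists_equiv_apply_eq (a := b) (b := r) (q := q) (x := x)
    (by simp [b, r]; omega) (Ne.symm hx.1)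
  have hfol : Follows (fun l => (nextRound proc (avoidingAdversary A proc q) l).support) g := by
    intro l ρ hl
    obtain ⟨h1, h2, h3⟩ := hg l ρ hl
    refine mem_support_nextRound.2 ⟨h1, h2, fun i => ?_⟩
    have hrec : reception ((avoidingAdversary A proc q).reach l ρ.mid)
        (A.transmission proc ((avoidingAdversary A proc q).bcast l) ρ.mid)
        (proc.symm i) = reception (avoiding (A.signal ρ.mid) q) (A.signal ρ.mid) i := by
      rw [hun.transmission]
      refine (reception_congr proc (R' := avoiding (A.signal ρ.mid) q) fun u hu => ?_).trans
        (by rw [proc.apply_symm_apply])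
      refine ⟨fun hadj => ?_, fun hadj => Or.inr hadj⟩
      rcases hadj with hadj | hadj
      · refine ⟨proc.injective.ne hadj.ne, ?_⟩
        rintro ⟨w, hwq, hw⟩
        have hwu := hw.2 _ hu
        refine ⟨hwu ▸ hwq, fun hv => ?_⟩
        have hvb : proc.symm i = b := proc.injective (hv.trans hb.symm)
        rw [hvb, spreadG_adj] at hadj
        have hur : u = r := by
          apply Fin.ext
          simp only [b, r] at hadj ⊢
          omega
        subst hur
        rw [hr] at hwu
        subst hwu
        exact hx.2 ρ (hl.subset (by simp)) hw
      · exact hadj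
    rw [hrec]
    exact h3 i
  obtain ⟨e, he, heg⟩ := hfol.exists_extension fun _ => PMF.support_nonempty _
  have hone : (avoidingAdversary A proc q).OneShot proc :=
    ⟨fun _ _ _ hbc => by simp [avoidingAdversary] at hbc, fun _ _ _ => rfl⟩
  have hgood := ((hA proc _ hone).1 e he).2
  intro ρ hρ
  obtain ⟨t, ht, rfl⟩ := List.mem_iff_getElem.1 hρ
  rw [← heg t ht, Finset.eq_empty_iff_forall_notMem]
  intro m hm
  obtain ⟨u, -, ⟨s, -, hs⟩, -⟩ := hgood.2 b m t (by rw [Round.Rcv, hb]; exact hm)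
  rw [Round.Bcast, IsExecution.bcast_eq he s] at hs
  simp [avoidingAdversary] at hs

end Distributed

/-! ## The adversary against distributed algorithms -/

/-- The links from a lone broadcaster are those of `H`, those from a lone receiver lead to all
broadcasters, and otherwise all links work. -/
def jamming {n : ℕ} {P : Type} (H : SimpleGraph (Fin n)) (tr : Fin n → Option P) :
    SimpleGraph (Fin n) where
  Adj u v := u ≠ v ∧ ∀ w, Lone tr w → (w.val < n / 2 → H.Adj u v) ∧
    (n / 2 ≤ w.val → (u.val < n / 2 ↔ n / 2 ≤ v.val))
  symm := ⟨fun u v h => ⟨h.1.symm, fun w hw => ⟨fun h1 => ((h.2 w hw).1 h1).symm, fun h1 => by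
    have := (h.2 w hw).2 h1
    omega⟩⟩⟩
  loopless := ⟨fun _ h => h.1 rfl⟩

/-- The pairs of a broadcaster and its own receiver. -/
def matchingGraph (n : ℕ) : SimpleGraph (Fin n) where
  Adj u v := (u.val < n / 2 ∧ v.val = n / 2 + u.val) ∨ (v.val < n / 2 ∧ u.val = n / 2 + v.val)
  symm := ⟨fun _ _ h => h.symm⟩
  loopless := ⟨fun _ h => by omega⟩

/-- All links of `spreadG` join a broadcaster to a receiver, so they survive in each case of
`jamming`, which is therefore a legal reach set. -/
theorem spreadG_le_jamming {n : ℕ} {P : Type} (tr : Fin n → Option P) :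
    spreadG n ≤ jamming (spreadG n) tr := by
  intro u v h
  refine ⟨h.ne, fun w _ => ⟨fun _ => h, fun _ => ?_⟩⟩
  rw [spreadG_adj] at h
  omega

/-- The assignment that puts the process `j` at the node `0`, and keeps the receivers with
their broadcasters. -/
def swapPairs {n : ℕ} (j : Fin n) (hj : j.val < n / 2) : Equiv.Perm (Fin n) :=
  Equiv.swap ⟨0, by omega⟩ j * Equiv.swap ⟨n / 2, by omega⟩ ⟨n / 2 + j.val, by omega⟩

/-! ### Moving a process to the node `0` -/

section SwapPairs

variable {n : ℕ} {j : Fin n} {hj : j.val < n / 2}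

theorem swapPairs_val (v : Fin n) : (swapPairs j hj v).val =
    if v.val = 0 then j.val else if v.val = j.val then 0
    else if v.val = n / 2 then n / 2 + j.val else if v.val = n / 2 + j.val then n / 2
    else v.val := by
  simp only [swapPairs, Equiv.Perm.mul_apply, Equiv.swap_apply_def, Fin.ext_iff]
  split_ifs <;> simp only at * <;> omega

theorem swapPairs_zero (h0 : 0 < n) : swapPairs j hj ⟨0, h0⟩ = j :=
  Fin.ext (by simp [swapPairs_val])

theorem swapPairs_lt (v : Fin n) : (swapPairs j hj v).val < n / 2 ↔ v.val < n / 2 := by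
  rw [swapPairs_val]
  split_ifs <;> omega

theorem swapPairs_pair {u : Fin n} (hu : u.val < n / 2) (v : Fin n) :
    (swapPairs j hj v).val = n / 2 + (swapPairs j hj u).val ↔ v.val = n / 2 + u.val := by
  rw [swapPairs_val, swapPairs_val]
  split_ifs <;> omega

/-- As long as the process at the node `0` does not transmit alone, all processes get the same
as if each broadcaster reached only its own receiver. -/
theorem reception_swapPairs {P : Type} {tr : Fin n → Option P} (hlone : ¬ Lone tr j) (i : Fin n) :
    reception (jamming (spreadG n) fun v => tr (swapPairs j hj v))
      (fun v => tr (swapPairs j hj v)) ((swapPairs j hj).symm i) =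
    reception (jamming (matchingGraph n) tr) tr i := by
  obtain ⟨v, rfl⟩ := (swapPairs j hj).surjective i
  rw [Equiv.symm_apply_apply]
  refine reception_congr (swapPairs j hj) fun u hu => ?_
  refine and_congr (swapPairs j hj).injective.ne_iff.symm ?_
  refine (swapPairs j hj).forall_congr fun w => ?_
  rw [lone_comp (swapPairs j hj)]
  refine imp_congr_right fun hw => ?_
  -- Only links from the lone transmitter matter. It is not at node `0`, and any other broadcaster
  -- has the same links in `spreadG` as in the matching.
  have hwu : u = w := (swapPairs j hj).injective (hw.2 _ hu)
  subst hwu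
  have hu0 : u.val ≠ 0 := fun h0 => by
    apply hlone
    have : u = ⟨0, by omega⟩ := Fin.ext h0
    rwa [this, swapPairs_zero] at hw
  have h1 := swapPairs_lt (hj := hj) u
  have h2 := swapPairs_lt (hj := hj) v
  refine and_congr ?_ (by omega)
  rw [h1]
  refine imp_congr_right fun hum => ?_
  have h3 := swapPairs_pair (hj := hj) hum v
  rw [spreadG_adj]
  simp only [matchingGraph]
  omega

end SwapPairs

/-! ### Coupling with the reference network -/

section Coupling

variable {n : ℕ} {M : Type}

/-- In the spread network with the assignment `π`, the process `i` is given
the message `μ i` if it is at a broadcaster; links behave as in `jamming`. -/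
def spreadAdversary (A : CentralizedAlgorithm (Fin n) n M) (μ : Fin n → M) (π : Fin n ≃ Fin n) :
    Adversary (spreadNetwork n) A where
  bcast h v := open Classical in if h = [] ∧ v.val < n / 2 then some (μ (π v)) else none
  reach _ s := jamming (spreadG n) fun v => A.signal s (π v)
  le_reach _ _ := spreadG_le_jamming _
  reach_le _ _ := le_top

/-- The network in which all links are unreliable. -/
def unreliableNetwork (n : ℕ) : DualGraph (Fin n) where
  G := ⊥
  G' := ⊤
  le := le_top

/-- Each process `i < n / 2` is given the message `μ i`, and as a lone transmitter
it reaches only the process `n / 2 + i`. -/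
def matchingAdversary (A : CentralizedAlgorithm (Fin n) n M) (μ : Fin n → M) :
    Adversary (unreliableNetwork n) A where
  bcast h i := open Classical in if h = [] ∧ i.val < n / 2 then some (μ i) else none
  reach _ s := jamming (matchingGraph n) (A.signal s)
  le_reach _ _ := bot_le
  reach_le _ _ := le_top

variable {A : CentralizedAlgorithm (Fin n) n M} {μ : Fin n → M}

theorem spreadAdversary_oneShot (hμ : Function.Injective μ) (π : Fin n ≃ Fin n) :
    (spreadAdversary A μ π).OneShot π := by
  classical
  refine ⟨fun h u m hm => ?_, fun h hne u => if_neg fun hh => hne hh.1⟩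
  have key : ∀ w, (spreadAdversary A μ π).bcast h w = some m → h = [] ∧ μ (π w) = m := by
    intro w hw
    simp only [spreadAdversary] at hw
    split_ifs at hw with hc
    exact ⟨hc.1, Option.some_injective _ hw⟩
  obtain ⟨rfl, hu⟩ := key u hm
  refine ⟨by simp, fun w hw => π.injective (hμ ((key w hw).2.trans hu.symm)), by simp⟩

theorem spreadAdversary_bcast_nil (π : Fin n ≃ Fin n) (u : Fin n) :
    ((spreadAdversary A μ π).bcast [] u).isSome ↔ u ∈ broadcasters n := by
  by_cases hu : u.val < n / 2 <;> simp [spreadAdversary, broadcasters, hu]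

/-- Transport of the inputs from the processes to the nodes. -/
def Round.relabel (π : Fin n ≃ Fin n) (ρ : Round A) : Round A :=
  { ρ with bcast := fun v => ρ.bcast (π v) }

theorem Round.relabel_injective (π : Fin n ≃ Fin n) :
    Function.Injective (Round.relabel (A := A) π) := by
  rintro ⟨b, _, _, _, _⟩ ⟨b', _, _, _, _⟩ h
  simp only [Round.relabel, Round.mk.injEq] at h
  obtain ⟨h1, h2⟩ := h
  have : b = b' := funext fun i => by simpa using congrFun h1 (π.symm i)
  simp only [Round.mk.injEq]
  exact ⟨this, h2⟩

theorem current_relabel (π : Fin n ≃ Fin n) (h : List (Round A)) :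
    A.current (h.map (Round.relabel π)) = A.current h := by
  rcases List.eq_nil_or_concat h with rfl | ⟨g, ρ, rfl⟩
  · rfl
  · rw [List.concat_eq_append, List.map_append, List.map_singleton, current_concat,
      current_concat]
    rfl

/-- The inputs travel with the processes, and as long as `j` is never alone the receptions agree by
`reception_swapPairs`. Hence all factors in `nextRound_apply` coincide, round by round. -/
theorem histories_relabel (hA : A.Unrestricted) {j : Fin n} (hj : j.val < n / 2) (k : ℕ)
    (h : List (Round A)) (hlone : ∀ ρ ∈ h, ¬ Lone (A.signal ρ.mid) j) :
    histories (swapPairs j hj) (spreadAdversary A μ (swapPairs j hj)) k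
      (h.map (Round.relabel (swapPairs j hj))) =
    histories (Equiv.refl _) (matchingAdversary A μ) k h := by
  classical
  induction k generalizing h with
  | zero => simp [histories, PMF.pure_apply]
  | succ k ih =>
    rcases List.eq_nil_or_concat h with rfl | ⟨g, ρ, rfl⟩
    · rw [List.map_nil, histories_succ_nil, histories_succ_nil]
    · rw [List.concat_eq_append] at hlone ⊢
      rw [List.map_append, List.map_singleton, histories_succ_concat, histories_succ_concat,
        ih g fun σ hσ => hlone σ (by simp [hσ])]
      congr 1
      rw [nextRound_apply, nextRound_apply, current_relabel]
      have hρ : ¬ Lone (A.signal ρ.mid) j := hlone ρ (by simp)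
      have hbc : ∀ v, (spreadAdversary A μ (swapPairs j hj)).bcast
          (g.map (Round.relabel (swapPairs j hj))) v =
          (matchingAdversary A μ).bcast g (swapPairs j hj v) := by
        intro v
        simp only [spreadAdversary, matchingAdversary, List.map_eq_nil_iff, swapPairs_lt]
      have hrec : ∀ i, reception ((spreadAdversary A μ (swapPairs j hj)).reach
            (g.map (Round.relabel (swapPairs j hj))) ρ.mid)
          (A.transmission (swapPairs j hj) ((spreadAdversary A μ (swapPairs j hj)).bcast
            (g.map (Round.relabel (swapPairs j hj)))) ρ.mid) ((swapPairs j hj).symm i) =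
          reception ((matchingAdversary A μ).reach g ρ.mid)
            (A.transmission (Equiv.refl _) ((matchingAdversary A μ).bcast g) ρ.mid)
            ((Equiv.refl _).symm i) := by
        intro i
        rw [hA.transmission, hA.transmission]
        exact reception_swapPairs hρ i
      have hcond : ((Round.relabel (swapPairs j hj) ρ).bcast =
          (spreadAdversary A μ (swapPairs j hj)).bcast
            (g.map (Round.relabel (swapPairs j hj)))) ↔
          ρ.bcast = (matchingAdversary A μ).bcast g := by
        constructor
        · intro hh
          funext i
          have := congrFun hh ((swapPairs j hj).symm i)
          rw [hbc, Equiv.apply_symm_apply] at this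
          simpa [Round.relabel] using this
        · intro hh
          funext v
          rw [hbc, ← hh]
          rfl
      by_cases hc : ρ.bcast = (matchingAdversary A μ).bcast g
      swap
      · rw [if_neg hc, if_neg (mt hcond.1 hc)]
      rw [if_pos hc, if_pos (hcond.2 hc)]
      refine congrArg₂ _ (Finset.prod_congr rfl fun i _ => ?_)
        (Finset.prod_congr rfl fun i _ => ?_)
      · rw [hbc, Equiv.apply_symm_apply]
        rfl
      · exact congrArg (fun r => A.recv i (ρ.mid i) r (ρ.final i, ρ.ackOut i, ρ.rcvOut i)) (hrec i)

/-- Some broadcaster is unlikely to transmit alone during the first `T` rounds. -/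
theorem exists_prob_lone_le (hn : 2 ≤ n) (μ : Fin n → M) (T : ℕ) :
    ∃ j : Fin n, j.val < n / 2 ∧
      prob (Equiv.refl _) (matchingAdversary A μ) T
        {h | ∃ ρ ∈ h, Lone (A.signal ρ.mid) j} ≤ T / ((n / 2 : ℕ) : ℝ≥0∞) := by
  classical
  set p := histories (Equiv.refl _) (matchingAdversary A μ) T with hp
  set s : Finset (Fin n) := Finset.univ.filter fun j => j.val < n / 2 with hs
  have hcard : s.card = n / 2 := by
    rw [hs, Fin.card_filter_val_lt]
    omega
  -- The sum is the expected number of broadcasters that are ever alone, and each round accounts for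
  -- at most one.
  have hsum : ∑ j ∈ s, p.toOuterMeasure {h | ∃ ρ ∈ h, Lone (A.signal ρ.mid) j} ≤ T := by
    simp only [PMF.toOuterMeasure_apply]
    rw [← Summable.tsum_finsetSum fun _ _ => ENNReal.summable]
    calc ∑' h, ∑ j ∈ s, Set.indicator {h | ∃ ρ ∈ h, Lone (A.signal ρ.mid) j} p h
        ≤ ∑' h, p h * T := ENNReal.tsum_le_tsum fun h => ?_
      _ = T := by rw [ENNReal.tsum_mul_right, p.tsum_coe, one_mul]
    by_cases hh : p h = 0
    · refine (Finset.sum_eq_zero fun j _ => ?_).trans_le zero_le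
      rw [Set.indicator_apply, hh, ite_self]
    · have hlen : h.length = T := (mem_support_histories.1 ((p.mem_support_iff h).2 hh)).1
      simp only [Set.indicator_apply, Set.mem_ofPred_eq]
      rw [← Finset.sum_filter, Finset.sum_const, nsmul_eq_mul, mul_comm]
      refine mul_le_mul_right ?_ _
      rw [← hlen]
      refine Nat.cast_le.2 ((Finset.card_le_card ?_).trans (card_lone_le h))
      exact Finset.filter_subset_filter _ (Finset.subset_univ _)
  have hm : ((n / 2 : ℕ) : ℝ≥0∞) ≠ 0 := Nat.cast_ne_zero.2 (by omega)
  obtain ⟨j, hj, hle⟩ := ENNReal.exists_le_of_sum_le (s := s)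
    (g := fun _ => T / ((n / 2 : ℕ) : ℝ≥0∞))
    (Finset.card_pos.1 (by omega)) (hsum.trans (by
      rw [Finset.sum_const, hcard, nsmul_eq_mul,
        ENNReal.mul_div_cancel hm (ENNReal.natCast_ne_top _)]))
  exact ⟨j, by simpa [hs] using hj, hle⟩

/-- The probability that the process at the node `0` transmits alone within the first `T` rounds
is at most what it is in the reference network. -/
theorem prob_lone_le (hA : A.Unrestricted) {j : Fin n} (hj : j.val < n / 2) {T k : ℕ}
    (hTk : T ≤ k) :
    prob (swapPairs j hj) (spreadAdversary A μ (swapPairs j hj)) k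
      {h | T ≤ h.length ∧ ∀ ρ ∈ h.take T, ¬ Lone (A.signal ρ.mid) j}ᶜ ≤
    prob (Equiv.refl _) (matchingAdversary A μ) T {h | ∃ ρ ∈ h, Lone (A.signal ρ.mid) j} := by
  classical
  set E : Set (List (Round A)) := {h | T ≤ h.length ∧ ∀ ρ ∈ h.take T, ¬ Lone (A.signal ρ.mid) j}
  set F : Set (List (Round A)) := {h | ∃ ρ ∈ h, Lone (A.signal ρ.mid) j}
  -- The clause `T ≤ h.length` makes `E` stable under further rounds, so it can be compared at time
  -- `T` and carried over to `k`.
  have hE : ∀ h ∈ E, ∀ ρ, h ++ [ρ] ∈ E := by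
    rintro h ⟨h1, h2⟩ ρ
    refine ⟨by simp; omega, ?_⟩
    rwa [List.take_append_of_le_length h1]
  -- Relabeling is injective and preserves point masses on histories where `j` is never alone, so
  -- their total mass embeds into that of `E`.
  have hFE : prob (Equiv.refl _) (matchingAdversary A μ) T Fᶜ ≤
      prob (swapPairs j hj) (spreadAdversary A μ (swapPairs j hj)) T E := by
    rw [prob, prob, PMF.toOuterMeasure_apply, PMF.toOuterMeasure_apply]
    refine le_trans (ENNReal.tsum_le_tsum fun h => ?_) (ENNReal.tsum_comp_le_tsum_of_injective
      (List.map_injective_iff.2 (Round.relabel_injective (swapPairs j hj))) _)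
    by_cases hh : h ∈ Fᶜ
    swap
    · rw [Set.indicator_of_notMem hh]
      exact zero_le
    rw [Set.indicator_of_mem hh]
    have hno : ∀ ρ ∈ h, ¬ Lone (A.signal ρ.mid) j := fun ρ hρ hl => hh ⟨ρ, hρ, hl⟩
    by_cases h0 : histories (Equiv.refl _) (matchingAdversary A μ) T h = 0
    · rw [h0]
      exact zero_le
    have hlen : h.length = T := (mem_support_histories.1 ((PMF.mem_support_iff _ _).2 h0)).1
    rw [Set.indicator_of_mem, histories_relabel hA hj T h hno]
    refine ⟨by simp [hlen], fun ρ hρ => ?_⟩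
    obtain ⟨σ, hσ, rfl⟩ := List.mem_map.1 (List.mem_of_mem_take hρ)
    exact hno σ hσ
  have h1 := prob_add_compl (swapPairs j hj) (spreadAdversary A μ (swapPairs j hj)) k E
  have h2 := prob_add_compl (Equiv.refl _) (matchingAdversary A μ) T F
  have h3 := hFE.trans (prob_le_prob_of_le hE hTk)
  have hfin : prob (Equiv.refl _) (matchingAdversary A μ) T Fᶜ ≠ ∞ :=
    ne_top_of_le_ne_top ENNReal.one_ne_top (h2 ▸ le_add_self)
  refine ENNReal.le_of_add_le_add_left hfin ?_
  refine (add_le_add_left h3 _).trans ?_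
  rw [h1, add_comm, h2]

end Coupling

/-! ## The lower bound -/

section Progress

variable {n : ℕ} {M : Type}

theorem firstReceive_append_le {A : CentralizedAlgorithm (Fin n) n M} (proc : Fin n ≃ Fin n)
    (h : List (Round A)) (ρ : Round A) (v : Fin n) :
    firstReceive proc (h ++ [ρ]) v ≤ firstReceive proc h v := by
  refine le_iInf₂ fun t ht => iInf₂_le t ?_
  obtain ⟨σ, hσ, hm⟩ := ht
  refine ⟨σ, ?_, hm⟩
  rw [List.getElem?_append_left (List.getElem?_eq_some_iff.1 hσ).1, hσ]

theorem averageProgress_append_le {N : DualGraph (Fin n)} {A : CentralizedAlgorithm (Fin n) n M}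
    (S : Finset (Fin n)) (proc : Fin n ≃ Fin n) (h : List (Round A)) (ρ : Round A) :
    averageProgress N S proc (h ++ [ρ]) ≤ averageProgress N S proc h :=
  ENNReal.div_le_div_right (Finset.sum_le_sum fun v _ => by
    exact_mod_cast firstReceive_append_le proc h ρ v) _

theorem lt_firstReceive {A : CentralizedAlgorithm (Fin n) n M} {proc : Fin n ≃ Fin n}
    {h : List (Round A)} {T : ℕ} {v : Fin n}
    (hv : ∀ ρ ∈ h.take T, ρ.rcvOut (proc v) = ∅) :
    ((T + 1 : ℕ) : ℕ∞) ≤ firstReceive proc h v := by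
  refine le_iInf₂ fun t ht => ?_
  obtain ⟨ρ, hρ, m, hm⟩ := ht
  refine Nat.cast_le.2 (Nat.succ_le_succ (not_lt.1 fun hlt => ?_))
  have hmem : ρ ∈ h.take T := by
    refine List.mem_of_getElem? (i := t) ?_
    rw [List.getElem?_take_of_lt hlt, hρ]
  rw [Round.Rcv, hv ρ hmem] at hm
  simp at hm

/-- A receiver hears something only if a broadcaster transmits alone. -/
theorem reception_jamming {P : Type} {tr : Fin n → Option P} (h0 : 0 < n)
    (hlone : ¬ Lone tr ⟨0, h0⟩) {v : Fin n} (hv : n / 2 ≤ v.val)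
    (hno : ∀ u, Lone tr u → v.val ≠ n / 2 + u.val) :
    reception (jamming (spreadG n) tr) tr v = ownReception (tr v) := by
  refine reception_eq_own fun htv => ?_
  rintro ⟨u, ⟨hu, hus⟩, huniq⟩
  by_cases hex : ∃ w, Lone tr w
  · obtain ⟨w, hw⟩ := hex
    have huw := hw.2 u hus
    subst huw
    have hu0 : u.val ≠ 0 := fun h => hlone (by
      rwa [show u = ⟨0, h0⟩ from Fin.ext h] at hw)
    have h1 := hno u hw
    have h2 := hu.2 u hw
    by_cases hum : u.val < n / 2
    · have h3 := h2.1 hum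
      rw [spreadG_adj] at h3
      omega
    · have h3 := h2.2 (by omega)
      omega
  · refine hex ⟨u, hus, fun w hws => huniq w ⟨⟨?_, fun x hx => (hex ⟨x, hx⟩).elim⟩, hws⟩⟩
    rintro rfl
    simp [htv] at hws

theorem card_receivers_spread (hn : 2 ≤ n) :
    (receivers (spreadNetwork n) (broadcasters n)).card = n - n / 2 := by
  classical
  have h1 : receivers (spreadNetwork n) (broadcasters n) =
      (Finset.univ.filter fun v : Fin n => v.val < n / 2)ᶜ := by
    ext v
    simp [mem_receivers_spread hn]
  rw [h1, Finset.card_compl, Fin.card_filter_val_lt, Fintype.card_fin]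
  omega

/-- Among the first `n / 4` rounds, each lets at most one receiver hear something, namely the
partner of a lone broadcaster. Every remaining receiver contributes at least `n / 4 + 1` to the sum.
-/
theorem le_averageProgress {A : CentralizedAlgorithm (Fin n) n M} (hn : 2 ≤ n)
    (hA : A.Unrestricted) (hsolve : SolvesOneShot (spreadNetwork n) A) {μ : Fin n → M}
    {j : Fin n} (hj : j.val < n / 2) {k : ℕ} {h : List (Round A)}
    (hh : h ∈ (histories (swapPairs j hj) (spreadAdversary A μ (swapPairs j hj)) k).support)
    (hlone : ∀ ρ ∈ h.take (n / 4), ¬ Lone (A.signal ρ.mid) j) :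
    ((n - n / 2 - n / 4 : ℕ) : ℝ≥0∞) * ((n / 4 + 1 : ℕ) : ℝ≥0∞) / ((n - n / 2 : ℕ) : ℝ≥0∞) ≤
      averageProgress (spreadNetwork n) (broadcasters n) (swapPairs j hj) h := by
  classical
  set π := swapPairs j hj with hπ
  set g := h.take (n / 4) with hg
  have hfol : Follows (fun l => (nextRound π (spreadAdversary A μ π) l).support) g :=
    fun l ρ hl => (mem_support_histories.1 hh).2 l ρ (hl.trans (List.take_prefix _ _))
  have hglen : g.length ≤ n / 4 := by simp [hg]
  let X : Finset (Fin n) := Finset.univ.filter fun i => ∃ ρ ∈ g, Lone (A.signal ρ.mid) i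
  let B : Finset (Fin n) := Finset.univ.filter fun v => ∃ i ∈ X, v.val = n / 2 + (π.symm i).val
  have hB : B.card ≤ n / 4 := by
    rw [← Finset.card_image_of_injective B Fin.val_injective]
    have hsub : B.image Fin.val ⊆ X.image fun i => n / 2 + (π.symm i).val := by
      intro a ha
      obtain ⟨v, hv, rfl⟩ := Finset.mem_image.1 ha
      obtain ⟨i, hi, hvi⟩ := (Finset.mem_filter.1 hv).2
      exact Finset.mem_image.2 ⟨i, hi, hvi.symm⟩
    exact (Finset.card_le_card hsub).trans
      (Finset.card_image_le.trans ((card_lone_le g).trans hglen))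
  have hsilent : ∀ v ∈ receivers (spreadNetwork n) (broadcasters n) \ B,
      ((n / 4 + 1 : ℕ) : ℝ≥0∞) ≤ (firstReceive π h v : ℝ≥0∞) := by
    intro v hv
    obtain ⟨hvr, hvB⟩ := Finset.mem_sdiff.1 hv
    rw [mem_receivers_spread hn] at hvr
    have key : ∀ ρ ∈ g, ρ.rcvOut (π v) = ∅ := by
      -- For `n < 4` the list `g` is empty.
      by_cases hn4 : 4 ≤ n
      swap
      · intro ρ hρ
        have h1 := List.length_pos_of_mem hρ
        omega
      refine rcvOut_eq_empty_of_silent hA hn4 hsolve hglen fun l ρ hl => ?_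
      have hρ : ρ ∈ g := hl.subset (by simp)
      obtain ⟨-, h2, h3⟩ := mem_support_nextRound.1 (hfol l ρ hl)
      have h2 := h2 (π v)
      have h3 := h3 (π v)
      rw [Equiv.symm_apply_apply] at h2 h3
      rw [show (spreadAdversary A μ π).bcast l v = none from if_neg fun hc => by omega] at h2
      refine ⟨h2, ?_⟩
      rw [hA.transmission] at h3
      rwa [show reception ((spreadAdversary A μ π).reach l ρ.mid)
          (fun v => A.signal ρ.mid (π v)) v = ownReception (A.signal ρ.mid (π v)) from
          reception_jamming (by omega) ?_ hvr ?_] at h3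
      · rw [lone_comp π, hπ, swapPairs_zero]
        exact hlone ρ hρ
      · intro u hu huv
        rw [lone_comp π] at hu
        refine hvB (Finset.mem_filter.2 ⟨Finset.mem_univ _, π u,
          Finset.mem_filter.2 ⟨Finset.mem_univ _, ρ, hρ, hu⟩, ?_⟩)
        rw [Equiv.symm_apply_apply]
        exact huv
    exact_mod_cast lt_firstReceive key
  rw [averageProgress, card_receivers_spread hn]
  refine ENNReal.div_le_div_right ?_ _
  calc ((n - n / 2 - n / 4 : ℕ) : ℝ≥0∞) * ((n / 4 + 1 : ℕ) : ℝ≥0∞)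
      ≤ ((receivers (spreadNetwork n) (broadcasters n) \ B).card : ℝ≥0∞) *
          ((n / 4 + 1 : ℕ) : ℝ≥0∞) := by
        refine mul_le_mul_left (Nat.cast_le.2 ?_) _
        have h1 := Finset.le_card_sdiff B (receivers (spreadNetwork n) (broadcasters n))
        rw [card_receivers_spread hn] at h1
        omega
    _ = ∑ v ∈ receivers (spreadNetwork n) (broadcasters n) \ B, ((n / 4 + 1 : ℕ) : ℝ≥0∞) := by
        rw [Finset.sum_const, nsmul_eq_mul]
    _ ≤ ∑ v ∈ receivers (spreadNetwork n) (broadcasters n) \ B,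
          (firstReceive π h v : ℝ≥0∞) := Finset.sum_le_sum hsilent
    _ ≤ ∑ v ∈ receivers (spreadNetwork n) (broadcasters n), (firstReceive π h v : ℝ≥0∞) :=
        Finset.sum_le_sum_of_subset Finset.sdiff_subset

/-- At least half of the receivers are silent, each contributing at least `n / 4 + 1 ≥ (n - 1) / 4`
(the last division being exact), so the average is at least `(n - 1) / 8`; the constant `1 / 16`
leaves room. -/
theorem lt_progress_bound (hn : 2 ≤ n) {f : ℝ≥0} (hf : f < 1 / 16 * (n - 1 : ℕ)) :
    (f : ℝ≥0∞) <
      ((n - n / 2 - n / 4 : ℕ) : ℝ≥0∞) * ((n / 4 + 1 : ℕ) : ℝ≥0∞) / ((n - n / 2 : ℕ) : ℝ≥0∞) := by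
  have hpos : 0 < n - n / 2 := by omega
  rw [ENNReal.lt_div_iff_mul_lt (Or.inl (Nat.cast_ne_zero.2 hpos.ne'))
    (Or.inl (ENNReal.natCast_ne_top _))]
  have key : f * ((n - n / 2 : ℕ) : ℝ≥0) <
      ((n - n / 2 - n / 4 : ℕ) : ℝ≥0) * ((n / 4 + 1 : ℕ) : ℝ≥0) := by
    rw [← NNReal.coe_lt_coe] at hf ⊢
    simp only [NNReal.coe_mul, NNReal.coe_natCast, NNReal.coe_div, NNReal.coe_one,
      NNReal.coe_ofNat, Nat.cast_add_one] at hf ⊢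
    set a : ℕ := n - n / 2
    have h1 : ((a : ℕ) : ℝ) ≤ 2 * ((a - n / 4 : ℕ) : ℝ) := by
      exact_mod_cast (by omega : a ≤ 2 * (a - n / 4))
    have h2 : ((n - 1 : ℕ) : ℝ) ≤ 4 * ((n / 4 : ℕ) + 1 : ℝ) := by
      exact_mod_cast (by omega : n - 1 ≤ 4 * (n / 4 + 1))
    have h3 : (0 : ℝ) < a := by exact_mod_cast hpos
    have h4 : (0 : ℝ) < ((n / 4 : ℕ) : ℝ) + 1 := by positivity
    calc (f : ℝ) * a < (((n / 4 : ℕ) + 1 : ℝ) / 2) * a :=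
          mul_lt_mul_of_pos_right (by linarith) h3
      _ ≤ ((a - n / 4 : ℕ) : ℝ) * ((n / 4 : ℕ) + 1 : ℝ) := by nlinarith
  exact_mod_cast key

/-- For `n ≥ 4` the left side is at most `1/2` and the right side at least `3/4`; for `n < 4` the
left side vanishes. -/
theorem quarter_div_half_lt (hn : 2 ≤ n) :
    ((n / 4 : ℕ) : ℝ≥0∞) / ((n / 2 : ℕ) : ℝ≥0∞) < 1 - 1 / (n : ℝ≥0∞) := by
  have hm : ((n / 2 : ℕ) : ℝ≥0) ≠ 0 := Nat.cast_ne_zero.2 (by omega)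
  have hn0 : (n : ℝ≥0) ≠ 0 := Nat.cast_ne_zero.2 (by omega)
  have key : ((n / 4 : ℕ) : ℝ≥0) / ((n / 2 : ℕ) : ℝ≥0) + 1 / (n : ℝ≥0) < 1 := by
    rw [div_add_div _ _ hm hn0, div_lt_one (by positivity)]
    have : n / 4 * n + n / 2 * 1 < n / 2 * n := by
      rcases Nat.lt_or_ge n 4 with h | h
      · interval_cases n <;> norm_num
      · have h1 : n / 4 * 2 ≤ n / 2 := by omega
        have h2 := Nat.mul_le_mul_right n h1
        have h3 := Nat.mul_le_mul_left (n / 2) (show 3 ≤ n by omega)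
        have h4 : 0 < n / 2 := by omega
        nlinarith
    exact_mod_cast this
  rw [lt_tsub_iff_right]
  have := ENNReal.coe_lt_coe.2 key
  rw [ENNReal.coe_add, ENNReal.coe_div hm, ENNReal.coe_div hn0] at this
  simpa only [ENNReal.coe_natCast, ENNReal.coe_one] using this

theorem le_of_hasAverageProgress [Infinite M] {A : CentralizedAlgorithm (Fin n) n M} (hn : 2 ≤ n)
    (hA : A.Unrestricted) (hsolve : SolvesOneShot (spreadNetwork n) A) {f : ℝ≥0}
    (hf : HasAverageProgress (spreadNetwork n) (broadcasters n) A f) :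
    1 / 16 * ((n - 1 : ℕ) : ℝ≥0) ≤ f := by
  by_contra! hlt
  let μ : Fin n → M := fun i => Infinite.natEmbedding M i.val
  have hμ : Function.Injective μ := (Infinite.natEmbedding M).injective.comp Fin.val_injective
  obtain ⟨j, hj, hprob⟩ := exists_prob_lone_le (A := A) hn μ (n / 4)
  have hbound := hf (swapPairs j hj) (spreadAdversary A μ (swapPairs j hj))
    (spreadAdversary_oneShot hμ _) (spreadAdversary_bcast_nil _)
  refine (quarter_div_half_lt hn).not_ge (hbound.trans (iSup_le fun k => ?_))
  refine le_trans ?_ hprob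
  -- The progress event only grows with time, so `k` may be raised to at least `n / 4`.
  refine le_trans ?_ (prob_lone_le (μ := μ) hA hj (le_max_right k (n / 4)))
  refine (prob_le_prob_of_le (fun h hh ρ => ?_) (le_max_left k (n / 4))).trans
    (prob_mono fun h hh hprog hE => ?_)
  · exact (averageProgress_append_le _ _ h ρ).trans hh
  · exact ((lt_progress_bound hn hlt).trans_le
      (le_averageProgress hn hA hsolve hj hh hE.2)).not_ge hprog

end Progress

end DualRadio

open DualRadio in
theorem mainTheorem7 :
    ∃ C c : ℝ≥0, 0 < c ∧ ∀ (M : Type) [Infinite M] (n : ℕ), 2 ≤ n →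
      (spreadNetwork n).maxDegree' = n - 1 ∧
      (∃ A : CentralizedAlgorithm (Fin n) n M,
        SolvesLocalBroadcast (spreadNetwork n) A ∧
        HasAverageProgress (spreadNetwork n) (broadcasters n) A C) ∧
      ∀ A : DistributedAlgorithm n M,
        SolvesOneShot (spreadNetwork n) (A.toCentralized (Fin n)) →
        ∀ f : ℝ≥0, HasAverageProgress (spreadNetwork n) (broadcasters n)
            (A.toCentralized (Fin n)) f →
          c * (spreadNetwork n).maxDegree' ≤ f := by
  refine ⟨1, 1 / 16, by norm_num, fun M _ n hn => ⟨maxDegree'_spread hn, ?_, ?_⟩⟩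
  · have : NeZero n := ⟨by omega⟩
    exact ⟨roundRobin n M, roundRobin_solves rfl, roundRobin_progress hn⟩
  · intro A hA f hf
    rw [maxDegree'_spread hn]
    exact le_of_hasAverageProgress hn A.unrestricted_toCentralized hA hf
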